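/- All graphs are finite and simplicial (no loops, no multiple edges). For a graph $\Gamma$, the right-angled Artin group $A_\Gamma$ is the group generated by the vertices of $\Gamma$, subject to the relations $[a,b]=1$ for every edge $\{a,b\}$ of $\Gamma$. For a vertex $v$, let $\mathrm{st}(v)$ be the set consisting of $v$ and all vertices adjacent to $v$. If $C$ is the vertex set of a (possibly empty) union of connected components of the induced subgraph $\Gamma\setminus\mathrm{st}(v)$, the partial conjugation $P_C^v$ is the automorphism of $A_\Gamma$ sending each vertex $w\in C$ to $vwv^{-1}$ and fixing every other vertex. An automorphism of $A_\Gamma$ is conjugating if it sends each vertex $v$ (viewed as a standard generator) to a conjugate of $v$. A covering map of graphs $\varphi:\Lambda\to\Gamma$ is a graph map, surjective on vertices, that restricts for each vertex $u$ of $\Lambda$ to a bijection from the vertices adjacent to $u$ onto the vertices adjacent to $\varphi(u)$. It is regular if, whenever $\varphi(u_1)=\varphi(u_2)$, there is a graph automorphism $\sigma$ of $\Lambda$ with $\varphi\circ\sigma=\varphi$ and $\sigma(u_1)=u_2$. Let $\phi:A_\Lambda\to A_\Gamma$ be the homomorphism induced by $\varphi$. An automorphism $f$ of $A_\Gamma$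 is liftable if there is an automorphism $F$ of $A_\Lambda$ with $f\circ\phi=\phi\circ F$. Let $\mathrm{LPAut}(\varphi)\le\mathrm{Aut}(A_\Gamma)$ be the group of all liftable conjugating automorphisms. Theorem. Let $\varphi:\Lambda\to\Gamma$ be a regular covering map of finite simplicial graphs without isolated vertices (neither graph needs to be connected). Then $\mathrm{LPAut}(\varphi)$ is generated by the liftable partial conjugations, i.e. it equals the subgroup of $\mathrm{Aut}(A_\Gamma)$ generated by the partial conjugations $P_C^v$ that are liftable. -/

import Mathlib

universe u v

open scoped commutatorElement

/-- The right-angled Artin group `A_Γ`: generators are the vertices of `Γ`, relators are the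
commutators `[a, b]` over the edges `{a, b}` of `Γ`. -/
abbrev RAAG {V : Type u} (Γ : SimpleGraph V) : Type u :=
  PresentedGroup {r : FreeGroup V | ∃ a b, Γ.Adj a b ∧ r = ⁅FreeGroup.of a, FreeGroup.of b⁆}

namespace RAAG

/-- The standard generator of `A_Γ` attached to a vertex. -/
def gen {V : Type u} (Γ : SimpleGraph V) (a : V) : RAAG Γ := PresentedGroup.of a

/-- Adjacent generators commute. -/
theorem gen_commute {V : Type u} {Γ : SimpleGraph V} {a b : V} (h : Γ.Adj a b) :
    Commute (gen Γ a) (gen Γ b) := by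
  have h1 : PresentedGroup.mk
      {r : FreeGroup V | ∃ a b, Γ.Adj a b ∧ r = ⁅FreeGroup.of a, FreeGroup.of b⁆}
      ⁅FreeGroup.of a, FreeGroup.of b⁆ = 1 :=
    PresentedGroup.one_of_mem ⟨a, b, h, rfl⟩
  rw [map_commutatorElement] at h1
  exact commutatorElement_eq_one_iff_mul_comm.mp h1

/-- The universal property: a map on vertices sending adjacent vertices to commuting elements
extends to a homomorphism. -/
def lift {V : Type u} {Γ : SimpleGraph V} {G : Type v} [Group G] (f : V → G)
    (hf : ∀ a b, Γ.Adj a b → Commute (f a) (f b)) : RAAG Γ →* G :=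
  PresentedGroup.toGroup (f := f) (by
    rintro r ⟨a, b, hab, rfl⟩
    rw [map_commutatorElement, FreeGroup.lift_apply_of, FreeGroup.lift_apply_of]
    exact commutatorElement_eq_one_iff_mul_comm.mpr (hf a b hab))

theorem lift_gen {V : Type u} {Γ : SimpleGraph V} {G : Type v} [Group G] (f : V → G)
    (hf : ∀ a b, Γ.Adj a b → Commute (f a) (f b)) (a : V) : lift f hf (gen Γ a) = f a :=
  PresentedGroup.toGroup.of _

/-- The homomorphism `A_Λ → A_Γ` induced by a graph map `Λ → Γ`. -/
def map {W : Type u} {V : Type v} {Λ : SimpleGraph W} {Γ : SimpleGraph V} (p : Λ →g Γ) :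
    RAAG Λ →* RAAG Γ :=
  lift (fun w => gen Γ (p w)) (fun _ _ h => gen_commute (p.map_adj h))

/-- The (vertex set of the) star of a vertex. -/
def star {V : Type u} (Γ : SimpleGraph V) (a : V) : Set V := insert a (Γ.neighborSet a)

/-- `C` is a union of connected components of `Γ \ st(a)`, the subgraph of `Γ` induced by the
vertices outside the star of `a`. -/
def IsUnionOfComponents {V : Type u} (Γ : SimpleGraph V) (a : V) (C : Set V) : Prop :=
  ∃ S : Set (Γ.induce (star Γ a)ᶜ).ConnectedComponent, C = Subtype.val '' (⋃ K ∈ S, K.supp)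

theorem IsUnionOfComponents.notMem_star {V : Type u} {Γ : SimpleGraph V} {a : V} {C : Set V}
    (hC : IsUnionOfComponents Γ a C) {b : V} (hb : b ∈ C) : b ∉ star Γ a := by
  obtain ⟨S, rfl⟩ := hC
  obtain ⟨x, -, rfl⟩ := hb
  exact x.2

theorem IsUnionOfComponents.mem_of_adj {V : Type u} {Γ : SimpleGraph V} {a : V} {C : Set V}
    (hC : IsUnionOfComponents Γ a C) {b c : V} (hb : b ∈ C) (hbc : Γ.Adj b c)
    (hc : c ∉ star Γ a) : c ∈ C := by
  obtain ⟨S, rfl⟩ := hC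
  obtain ⟨x, hx, rfl⟩ := hb
  simp only [Set.mem_iUnion, SimpleGraph.ConnectedComponent.mem_supp_iff] at hx
  obtain ⟨K, hK, rfl⟩ := hx
  refine ⟨⟨c, hc⟩, ?_, rfl⟩
  simp only [Set.mem_iUnion, SimpleGraph.ConnectedComponent.mem_supp_iff]
  refine ⟨_, hK, SimpleGraph.ConnectedComponent.sound ?_⟩
  exact SimpleGraph.Adj.reachable (G := Γ.induce (star Γ a)ᶜ) hbc.symm

theorem IsUnionOfComponents.commute_gen {V : Type u} {Γ : SimpleGraph V} {a : V} {C : Set V}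
    (hC : IsUnionOfComponents Γ a C) {b c : V} (hb : b ∈ C) (hbc : Γ.Adj b c) (hc : c ∉ C) :
    Commute (gen Γ a) (gen Γ c) := by
  by_cases h : c ∈ star Γ a
  · rcases h with rfl | h
    · exact Commute.refl _
    · exact gen_commute h
  · exact absurd (hC.mem_of_adj hb hbc h) hc

open Classical in
/-- The endomorphism conjugating the vertices in `C` by `g` and fixing all other vertices, where `g`
commutes with every vertex outside `C` that is adjacent to a vertex in `C`. -/
noncomputable def conjHom {V : Type u} {Γ : SimpleGraph V} (C : Set V) (g : RAAG Γ)
    (hg : ∀ b c, b ∈ C → Γ.Adj b c → c ∉ C → Commute g (gen Γ c)) : RAAG Γ →* RAAG Γ :=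
  lift (fun b => if b ∈ C then g * gen Γ b * g⁻¹ else gen Γ b) (by
    intro b c hbc
    have key : ∀ b c, Γ.Adj b c → b ∈ C → c ∉ C →
        Commute (g * gen Γ b * g⁻¹) (gen Γ c) := fun b c h hb hc =>
      ((hg b c hb h hc).mul_left (gen_commute h)).mul_left (hg b c hb h hc).inv_left
    split_ifs with hb hc hc
    · exact Commute.conj_iff g |>.mpr (gen_commute hbc)
    · exact key b c hbc hb hc
    · exact (key c b hbc.symm hc hb).symm
    · exact gen_commute hbc)

theorem conjHom_gen_of_mem {V : Type u} {Γ : SimpleGraph V} (C : Set V) (g : RAAG Γ)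
    (hg : ∀ b c, b ∈ C → Γ.Adj b c → c ∉ C → Commute g (gen Γ c)) {b : V} (hb : b ∈ C) :
    conjHom C g hg (gen Γ b) = g * gen Γ b * g⁻¹ := by
  rw [conjHom, lift_gen, if_pos hb]

theorem conjHom_gen_of_notMem {V : Type u} {Γ : SimpleGraph V} (C : Set V) (g : RAAG Γ)
    (hg : ∀ b c, b ∈ C → Γ.Adj b c → c ∉ C → Commute g (gen Γ c)) {b : V} (hb : b ∉ C) :
    conjHom C g hg (gen Γ b) = gen Γ b := by
  rw [conjHom, lift_gen, if_neg hb]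

theorem conjHom_comp_conjHom {V : Type u} {Γ : SimpleGraph V} (C : Set V) (g k : RAAG Γ)
    (hg : ∀ b c, b ∈ C → Γ.Adj b c → c ∉ C → Commute g (gen Γ c))
    (hk : ∀ b c, b ∈ C → Γ.Adj b c → c ∉ C → Commute k (gen Γ c))
    (hgk : k * g = 1) (hfix : conjHom C g hg k = k) :
    (conjHom C g hg).comp (conjHom C k hk) = MonoidHom.id _ := by
  refine PresentedGroup.ext fun b => ?_
  change conjHom C g hg (conjHom C k hk (gen Γ b)) = gen Γ b
  by_cases hb : b ∈ C
  · rw [conjHom_gen_of_mem C k hk hb, map_mul, map_mul, map_inv, hfix,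
      conjHom_gen_of_mem C g hg hb, eq_inv_of_mul_eq_one_left hgk]
    group
  · rw [conjHom_gen_of_notMem C k hk hb, conjHom_gen_of_notMem C g hg hb]

/-- The partial conjugation `P_C^a`: it sends each vertex `b ∈ C` to `a b a⁻¹` and fixes all other
vertices, where `C` is a union of components of `Γ \ st(a)`. -/
noncomputable def partialConj {V : Type u} {Γ : SimpleGraph V} (a : V) (C : Set V)
    (hC : IsUnionOfComponents Γ a C) : MulAut (RAAG Γ) :=
  have ha : a ∉ C := fun h => hC.notMem_star h (Set.mem_insert _ _)
  have h1 : ∀ b c, b ∈ C → Γ.Adj b c → c ∉ C → Commute (gen Γ a) (gen Γ c) :=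
    fun _ _ hb hbc hc => hC.commute_gen hb hbc hc
  have h2 : ∀ b c, b ∈ C → Γ.Adj b c → c ∉ C → Commute (gen Γ a)⁻¹ (gen Γ c) :=
    fun b c hb hbc hc => (h1 b c hb hbc hc).inv_left
  MonoidHom.toMulEquiv (conjHom C (gen Γ a) h1) (conjHom C (gen Γ a)⁻¹ h2)
    (conjHom_comp_conjHom C _ _ h2 h1 (mul_inv_cancel _) (conjHom_gen_of_notMem C _ h2 ha))
    (conjHom_comp_conjHom C _ _ h1 h2 (inv_mul_cancel _)
      (by rw [map_inv, conjHom_gen_of_notMem C _ h1 ha]))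

/-- `f` is a partial conjugation. -/
def IsPartialConj {V : Type u} {Γ : SimpleGraph V} (f : MulAut (RAAG Γ)) : Prop :=
  ∃ (a : V) (C : Set V) (hC : IsUnionOfComponents Γ a C), f = partialConj a C hC

/-- The group of conjugating automorphisms of `A_Γ`: those sending each standard generator to a
conjugate of itself. -/
def PAut {V : Type u} (Γ : SimpleGraph V) : Subgroup (MulAut (RAAG Γ)) where
  carrier := {f | ∀ a, IsConj (gen Γ a) (f (gen Γ a))}
  one_mem' := fun a => IsConj.refl _
  mul_mem' := fun {f g} hf hg a => (hf a).trans (f.toMonoidHom.map_isConj (hg a))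
  inv_mem' := fun {f} hf a => by
    have h := (f⁻¹ : MulAut (RAAG Γ)).toMonoidHom.map_isConj (hf a)
    have e : (f⁻¹ : MulAut (RAAG Γ)).toMonoidHom (f (gen Γ a)) = gen Γ a :=
      MulAut.inv_apply_self _ f _
    rw [e] at h
    exact h.symm

/-- `F` is a lift of `f`, i.e. `f ∘ φ = φ ∘ F` where `φ : A_Λ → A_Γ` is induced by `p`. -/
def IsLift {W : Type u} {V : Type v} {Λ : SimpleGraph W} {Γ : SimpleGraph V} (p : Λ →g Γ)
    (F : MulAut (RAAG Λ)) (f : MulAut (RAAG Γ)) : Prop :=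
  ∀ x : RAAG Λ, f (map p x) = map p (F x)

/-- The group of liftable automorphisms of `A_Γ`. -/
def LAut {W : Type u} {V : Type v} {Λ : SimpleGraph W} {Γ : SimpleGraph V} (p : Λ →g Γ) :
    Subgroup (MulAut (RAAG Γ)) where
  carrier := {f | ∃ F : MulAut (RAAG Λ), IsLift p F f}
  one_mem' := ⟨1, fun _ => rfl⟩
  mul_mem' := fun {f g} ⟨F, hF⟩ ⟨G, hG⟩ => ⟨F * G, fun x => by
    rw [MulAut.mul_apply, MulAut.mul_apply, hG, hF]⟩
  inv_mem' := fun {f} ⟨F, hF⟩ => ⟨F⁻¹, fun x => by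
    have h := hF (F⁻¹ x)
    rw [MulAut.apply_inv_self] at h
    rw [← h, MulAut.inv_apply_self]⟩

/-- The group of liftable conjugating automorphisms of `A_Γ`. -/
def LPAut {W : Type u} {V : Type v} {Λ : SimpleGraph W} {Γ : SimpleGraph V} (p : Λ →g Γ) :
    Subgroup (MulAut (RAAG Γ)) :=
  LAut p ⊓ PAut Γ

/-- A covering map of graphs: a surjective graph map which restricts to a bijection from the
neighbours of each vertex `w` onto the neighbours of `p w`. -/
structure IsCovering {W : Type u} {V : Type v} {Λ : SimpleGraph W} {Γ : SimpleGraph V}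
    (p : Λ →g Γ) : Prop where
  surjective : Function.Surjective p
  bijOn : ∀ w, Set.BijOn p (Λ.neighborSet w) (Γ.neighborSet (p w))

/-- The deck transformations: graph automorphisms `σ` of `Λ` with `p ∘ σ = p`. -/
def IsDeck {W : Type u} {V : Type v} {Λ : SimpleGraph W} {Γ : SimpleGraph V} (p : Λ →g Γ)
    (σ : Λ ≃g Λ) : Prop :=
  ∀ w, p (σ w) = p w

/-- A regular covering map: the deck transformations act transitively on each fibre. -/
structure IsRegularCovering {W : Type u} {V : Type v} {Λ : SimpleGraph W} {Γ : SimpleGraph V}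
    (p : Λ →g Γ) : Prop extends IsCovering p where
  transitive : ∀ w₁ w₂, p w₁ = p w₂ → ∃ σ : Λ ≃g Λ, IsDeck p σ ∧ σ w₁ = w₂

end RAAG

/-!
Every element of `A_Γ` has a normal form, its piling, from which one reads off the letters that can
begin a reduced word for it; these first letters cut the Cayley graph into half-spaces.

Let `f` be a nontrivial liftable conjugating automorphism. Some half-space `K` at a vertex `a` can
be chosen so that the elements conjugating the generators become shorter once `f` is multiplied by
the partial conjugation by `a` supported on the vertices which `f` conjugates into `K`, or by its
inverse. So it is enough to show that this partial conjugation is liftable.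

Correct a lift of `f` by a deck transformation until it acts trivially on homology. Remove the stars
of the fiber of `a` from `Λ`, and say that a component of the rest straddles if it lies next to the
stars of two vertices of the fiber. An element outside the parabolic subgroup of `V \ {a}` skewers a
half-space at `a`; comparing exponent sums, one finds that, modulo that parabolic subgroup, `f`
conjugates the images of the vertices of all straddling components by the same element. So the
partial conjugation moves the images of all these components or of none. In the latter case it
lifts: conjugate every other component by the only vertex of the fiber that it touches. In the
former case the complementary partial conjugation lifts for the same reason, and the product of the
two is inner.
-/

namespace RAAG

/-! ### Pilings -/

section Piling

variable {V : Type u} {Γ : SimpleGraph V}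

/-- A letter `a ^ ±1`, encoded as in `FreeGroup`: `(a, true)` is `a` and `(a, false)` is `a⁻¹`. -/
abbrev Letter (V : Type u) : Type u := V × Bool

/-- The inverse letter. -/
def Letter.inv (s : Letter V) : Letter V := (s.1, !s.2)

@[simp] theorem Letter.inv_inv (s : Letter V) : s.inv.inv = s := by simp [Letter.inv]

@[simp] theorem Letter.inv_fst (s : Letter V) : s.inv.1 = s.1 := rfl

theorem Letter.inv_ne (s : Letter V) : s.inv ≠ s := fun h =>
  Bool.not_ne_self s.2 (congrArg Prod.snd h)

/-- A family of stacks, one for each vertex, recording a word: the entry `some ε` on the stack of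
`a` stands for a letter `a ^ ±1`, the entry `none` for a letter that neither is `a ^ ±1` nor
commutes with `a`. -/
abbrev Stacks (V : Type u) : Type u := V → List (Option Bool)

/-- The stack of `s.1` carries the letter `s` on top. In a piling this says that some reduced word
for the recorded element begins with `s`. -/
def HasTop (P : Stacks V) (s : Letter V) : Prop := (P s.1).head? = some (some s.2)

open Classical in
/-- Put the letter `s` in front of the recorded word. -/
noncomputable def push (Γ : SimpleGraph V) (s : Letter V) (P : Stacks V) : Stacks V := fun b =>
  if b = s.1 then some s.2 :: P b else if Γ.Adj s.1 b then P b else none :: P b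

open Classical in
/-- Undo `push Γ s` for a letter `s` with vertex `a`. -/
noncomputable def pop (Γ : SimpleGraph V) (a : V) (P : Stacks V) : Stacks V := fun b =>
  if Γ.Adj a b then P b else (P b).tail

/-- The families of stacks that record reduced words: a normal form for the elements of `A_Γ`. -/
inductive IsPiling (Γ : SimpleGraph V) : Stacks V → Prop
  | nil : IsPiling Γ fun _ => []
  | cons (s : Letter V) (P : Stacks V) :
      IsPiling Γ P → ¬ HasTop P s.inv → IsPiling Γ (push Γ s P)

theorem pop_push (s : Letter V) (P : Stacks V) : pop Γ s.1 (push Γ s P) = P := by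
  funext b
  rcases eq_or_ne b s.1 with rfl | hb
  · simp [pop, push]
  · by_cases hadj : Γ.Adj s.1 b <;> simp [pop, push, hb, hadj]

theorem hasTop_push_self (s : Letter V) (P : Stacks V) : HasTop (push Γ s P) s := by
  simp [HasTop, push]

theorem hasTop_push_of_adj {s t : Letter V} (h : Γ.Adj s.1 t.1) (P : Stacks V) :
    HasTop (push Γ s P) t ↔ HasTop P t := by
  simp [HasTop, push, h, h.ne']

theorem eq_or_adj_of_hasTop_push {s t : Letter V} {P : Stacks V} (h : HasTop (push Γ s P) t) :
    t = s ∨ Γ.Adj s.1 t.1 := by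
  by_cases heq : t.1 = s.1
  · exact Or.inl (Prod.ext heq (by simpa [HasTop, push, heq, eq_comm] using h))
  · by_contra! hne
    simp [HasTop, push, heq, hne.2] at h

theorem push_push_comm {s t : Letter V} (h : Γ.Adj s.1 t.1) (P : Stacks V) :
    push Γ s (push Γ t P) = push Γ t (push Γ s P) := by
  funext b
  by_cases hs : b = s.1
  · simp [push, hs, h.ne, h.symm]
  by_cases ht : b = t.1
  · simp [push, ht, h.ne', h]
  by_cases hsb : Γ.Adj s.1 b <;> by_cases htb : Γ.Adj t.1 b <;> simp [push, hs, ht, hsb, htb]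

theorem IsPiling.exists_eq_push {P : Stacks V} (hP : IsPiling Γ P) {s : Letter V}
    (h : HasTop P s) : ∃ Q, IsPiling Γ Q ∧ ¬ HasTop Q s.inv ∧ P = push Γ s Q := by
  induction hP with
  | nil => simp [HasTop] at h
  | cons t P hP ht ih =>
    rcases eq_or_adj_of_hasTop_push h with rfl | hadj
    · exact ⟨P, hP, ht, rfl⟩
    · obtain ⟨Q, hQ, hs, rfl⟩ := ih ((hasTop_push_of_adj hadj _).1 h)
      exact ⟨push Γ t Q, .cons t Q hQ (mt (hasTop_push_of_adj (t := t.inv) hadj.symm _).2 ht),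
        mt (hasTop_push_of_adj (t := s.inv) hadj _).1 hs, push_push_comm hadj _⟩

theorem IsPiling.eq_or_adj_of_hasTop {P : Stacks V} (hP : IsPiling Γ P) {s t : Letter V}
    (hs : HasTop P s) (ht : HasTop P t) : t = s ∨ Γ.Adj s.1 t.1 := by
  obtain ⟨Q, -, -, rfl⟩ := hP.exists_eq_push hs
  exact eq_or_adj_of_hasTop_push ht

open Classical in
/-- The left multiplication by the letter `s` on pilings: it cancels `s⁻¹` where that is on top. -/
noncomputable def applyLetter (Γ : SimpleGraph V) (s : Letter V) (P : Stacks V) : Stacks V :=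
  if HasTop P s.inv then pop Γ s.1 P else push Γ s P

theorem applyLetter_of_not_hasTop {s : Letter V} {P : Stacks V} (h : ¬ HasTop P s.inv) :
    applyLetter Γ s P = push Γ s P := if_neg h

theorem applyLetter_push_inv (s : Letter V) (P : Stacks V) :
    applyLetter Γ s (push Γ s.inv P) = P := by
  rw [applyLetter, if_pos (hasTop_push_self _ _), ← s.inv_fst, pop_push]

theorem applyLetter_inv_push (s : Letter V) (P : Stacks V) :
    applyLetter Γ s.inv (push Γ s P) = P := by
  simpa only [Letter.inv_inv] using applyLetter_push_inv (Γ := Γ) s.inv P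

theorem isPiling_applyLetter {P : Stacks V} (hP : IsPiling Γ P) (s : Letter V) :
    IsPiling Γ (applyLetter Γ s P) := by
  by_cases h : HasTop P s.inv
  · obtain ⟨Q, hQ, -, rfl⟩ := hP.exists_eq_push h
    rwa [applyLetter_push_inv]
  · rw [applyLetter_of_not_hasTop h]
    exact .cons s P hP h

theorem IsPiling.applyLetter_applyLetter_inv {P : Stacks V} (hP : IsPiling Γ P) (s : Letter V) :
    applyLetter Γ s (applyLetter Γ s.inv P) = P := by
  by_cases h : HasTop P s
  · obtain ⟨Q, -, hs, rfl⟩ := hP.exists_eq_push h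
    rw [applyLetter_inv_push, applyLetter_of_not_hasTop hs]
  · rw [applyLetter_of_not_hasTop (s := s.inv) (by rwa [s.inv_inv]), applyLetter_push_inv]

theorem IsPiling.hasTop_applyLetter_self {P : Stacks V} (hP : IsPiling Γ P) (s : Letter V) :
    HasTop (applyLetter Γ s P) s ↔ ¬ HasTop P s.inv := by
  by_cases h : HasTop P s.inv
  · obtain ⟨Q, -, hs, rfl⟩ := hP.exists_eq_push h
    rw [s.inv_inv] at hs
    simp only [applyLetter_push_inv, hs, h, not_true_eq_false]
  · simp only [applyLetter_of_not_hasTop h, hasTop_push_self, h, not_false_eq_true]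

theorem IsPiling.hasTop_applyLetter_of_adj {P : Stacks V} (hP : IsPiling Γ P) {s t : Letter V}
    (h : Γ.Adj s.1 t.1) : HasTop (applyLetter Γ s P) t ↔ HasTop P t := by
  by_cases hs : HasTop P s.inv
  · obtain ⟨Q, -, -, rfl⟩ := hP.exists_eq_push hs
    rw [applyLetter_push_inv, hasTop_push_of_adj (s := s.inv) h]
  · rw [applyLetter_of_not_hasTop hs, hasTop_push_of_adj h]

theorem IsPiling.applyLetter_push_of_adj {P : Stacks V} (hP : IsPiling Γ P) {s t : Letter V}
    (h : Γ.Adj s.1 t.1) :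
    applyLetter Γ s (push Γ t P) = push Γ t (applyLetter Γ s P) := by
  by_cases hs : HasTop P s.inv
  · obtain ⟨Q, -, -, rfl⟩ := hP.exists_eq_push hs
    rw [push_push_comm (t := s.inv) h.symm, applyLetter_push_inv, applyLetter_push_inv]
  · rw [applyLetter_of_not_hasTop hs, push_push_comm h.symm,
      applyLetter_of_not_hasTop (by rwa [hasTop_push_of_adj (t := s.inv) h.symm])]

theorem IsPiling.applyLetter_comm {P : Stacks V} (hP : IsPiling Γ P) {s t : Letter V}
    (h : Γ.Adj s.1 t.1) :
    applyLetter Γ s (applyLetter Γ t P) = applyLetter Γ t (applyLetter Γ s P) := by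
  by_cases ht : HasTop P t.inv
  · obtain ⟨Q, hQ, -, rfl⟩ := hP.exists_eq_push ht
    rw [applyLetter_push_inv, hQ.applyLetter_push_of_adj (t := t.inv) h, applyLetter_push_inv]
  · rw [applyLetter_of_not_hasTop ht, hP.applyLetter_push_of_adj h,
      applyLetter_of_not_hasTop (s := t)]
    rwa [hP.hasTop_applyLetter_of_adj (t := t.inv) h]

/-- The type of pilings, on which `A_Γ` acts as it does on itself by left multiplication. -/
abbrev Piling (Γ : SimpleGraph V) : Type u := {P : Stacks V // IsPiling Γ P}

/-- The action of `A_Γ` on the pilings. -/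
noncomputable def act (Γ : SimpleGraph V) : RAAG Γ →* Equiv.Perm (Piling Γ) :=
  lift
    (fun a =>
      { toFun := fun P => ⟨applyLetter Γ (a, true) P.1, isPiling_applyLetter P.2 _⟩
        invFun := fun P => ⟨applyLetter Γ (a, false) P.1, isPiling_applyLetter P.2 _⟩
        left_inv := fun P => Subtype.ext (P.2.applyLetter_applyLetter_inv (a, false))
        right_inv := fun P => Subtype.ext (P.2.applyLetter_applyLetter_inv (a, true)) })
    fun _ _ h => Equiv.ext fun P => Subtype.ext (P.2.applyLetter_comm h)

end Piling

/-! ### Reduced words -/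

section Words

variable {V : Type u} {Γ : SimpleGraph V}

/-- The element of `A_Γ` represented by a word in the generators and their inverses. -/
def ofWord (Γ : SimpleGraph V) (l : List (Letter V)) : RAAG Γ :=
  PresentedGroup.mk _ (FreeGroup.mk l)

/-- The element of `A_Γ` represented by a letter. -/
def letter (Γ : SimpleGraph V) (s : Letter V) : RAAG Γ := ofWord Γ [s]

@[simp] theorem ofWord_nil : ofWord Γ [] = 1 := rfl

theorem ofWord_append (l l' : List (Letter V)) :
    ofWord Γ (l ++ l') = ofWord Γ l * ofWord Γ l' := rfl

theorem ofWord_cons (s : Letter V) (l : List (Letter V)) :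
    ofWord Γ (s :: l) = letter Γ s * ofWord Γ l := rfl

theorem ofWord_invRev (l : List (Letter V)) :
    ofWord Γ (FreeGroup.invRev l) = (ofWord Γ l)⁻¹ := rfl

theorem exists_ofWord_eq (g : RAAG Γ) : ∃ l, ofWord Γ l = g := by
  obtain ⟨x, rfl⟩ := PresentedGroup.mk_surjective _ g
  obtain ⟨l, rfl⟩ := Quot.exists_rep x
  exact ⟨l, rfl⟩

theorem letter_true (a : V) : letter Γ (a, true) = gen Γ a := rfl

theorem letter_false (a : V) : letter Γ (a, false) = (gen Γ a)⁻¹ := rfl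

@[simp] theorem letter_inv (s : Letter V) : letter Γ s.inv = (letter Γ s)⁻¹ := rfl

theorem letter_commute {s t : Letter V} (h : Γ.Adj s.1 t.1) :
    Commute (letter Γ s) (letter Γ t) := by
  have := gen_commute h
  rcases s with ⟨a, _ | _⟩ <;> rcases t with ⟨b, _ | _⟩ <;>
    simpa only [letter_true, letter_false, Commute.inv_left_iff, Commute.inv_right_iff] using this

theorem act_letter (s : Letter V) (P : Piling Γ) :
    (act Γ (letter Γ s) P).1 = applyLetter Γ s P.1 := by
  rcases s with ⟨a, _ | _⟩ <;> rfl

/-- Some reduced word for `g` has first letter `s`. This is read off the piling of `g`; for the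
description in terms of word length see `startsWith_iff_wordLength_lt`. -/
def StartsWith (s : Letter V) (g : RAAG Γ) : Prop := HasTop (act Γ g ⟨_, .nil⟩).1 s

theorem not_startsWith_one (s : Letter V) : ¬ StartsWith s (1 : RAAG Γ) := by
  simp [StartsWith, HasTop]

theorem startsWith_letter_mul {s : Letter V} {g : RAAG Γ} :
    StartsWith s (letter Γ s * g) ↔ ¬ StartsWith s.inv g := by
  rw [StartsWith, map_mul, Equiv.Perm.mul_apply, act_letter]
  exact (act Γ g _).2.hasTop_applyLetter_self s

theorem startsWith_letter_mul_of_adj {s t : Letter V} (h : Γ.Adj t.1 s.1) {g : RAAG Γ} :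
    StartsWith s (letter Γ t * g) ↔ StartsWith s g := by
  rw [StartsWith, map_mul, Equiv.Perm.mul_apply, act_letter]
  exact (act Γ g _).2.hasTop_applyLetter_of_adj h

theorem StartsWith.eq_or_adj {s t : Letter V} {g : RAAG Γ} (hs : StartsWith s g)
    (ht : StartsWith t g) : t = s ∨ Γ.Adj s.1 t.1 :=
  (act Γ g _).2.eq_or_adj_of_hasTop hs ht

theorem StartsWith.not_inv {s : Letter V} {g : RAAG Γ} (h : StartsWith s g) :
    ¬ StartsWith s.inv g := fun h' =>
  (h.eq_or_adj h').elim s.inv_ne (Γ.irrefl (v := s.1))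

theorem startsWith_inv_letter_inv_mul {s : Letter V} {g : RAAG Γ} :
    StartsWith s.inv ((letter Γ s)⁻¹ * g) ↔ ¬ StartsWith s g := by
  rw [← letter_inv, startsWith_letter_mul, Letter.inv_inv]

theorem not_startsWith_inv_letter_inv_mul {s : Letter V} {g : RAAG Γ} :
    ¬ StartsWith s.inv ((letter Γ s)⁻¹ * g) ↔ StartsWith s g := by
  rw [startsWith_inv_letter_inv_mul, not_not]

theorem startsWith_letter (s : Letter V) : StartsWith s (letter Γ s) := by
  simpa only [mul_one] using startsWith_letter_mul.2 (not_startsWith_one (Γ := Γ) s.inv)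

theorem startsWith_letter_iff {s t : Letter V} : StartsWith s (letter Γ t) ↔ s = t := by
  refine ⟨fun h => ((startsWith_letter t).eq_or_adj h).resolve_right fun hadj => ?_,
    fun h => h ▸ startsWith_letter s⟩
  rw [← mul_one (letter Γ t), startsWith_letter_mul_of_adj hadj] at h
  exact not_startsWith_one s h

/-- The word length of an element of `A_Γ` with respect to the standard generators. -/
noncomputable def wordLength (g : RAAG Γ) : ℕ := sInf (List.length '' {l | ofWord Γ l = g})

theorem wordLength_ofWord_le (l : List (Letter V)) : wordLength (ofWord Γ l) ≤ l.length :=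
  Nat.sInf_le ⟨l, rfl, rfl⟩

theorem exists_ofWord_eq_and_length_eq (g : RAAG Γ) :
    ∃ l, ofWord Γ l = g ∧ l.length = wordLength g :=
  Nat.sInf_mem (Set.Nonempty.image _ (exists_ofWord_eq g))

theorem wordLength_mul_le (g h : RAAG Γ) : wordLength (g * h) ≤ wordLength g + wordLength h := by
  obtain ⟨l, rfl, hl⟩ := exists_ofWord_eq_and_length_eq g
  obtain ⟨l', rfl, hl'⟩ := exists_ofWord_eq_and_length_eq h
  rw [← hl, ← hl', ← ofWord_append, ← List.length_append]
  exact wordLength_ofWord_le _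

theorem wordLength_inv_le (g : RAAG Γ) : wordLength g⁻¹ ≤ wordLength g := by
  obtain ⟨l, rfl, hl⟩ := exists_ofWord_eq_and_length_eq g
  rw [← hl, ← FreeGroup.invRev_length, ← ofWord_invRev]
  exact wordLength_ofWord_le _

@[simp] theorem wordLength_inv (g : RAAG Γ) : wordLength g⁻¹ = wordLength g :=
  le_antisymm (wordLength_inv_le g) (by simpa only [inv_inv] using wordLength_inv_le g⁻¹)

@[simp] theorem wordLength_one : wordLength (1 : RAAG Γ) = 0 :=
  Nat.le_zero.1 (wordLength_ofWord_le [])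

theorem eq_one_of_wordLength_eq_zero {g : RAAG Γ} (h : wordLength g = 0) : g = 1 := by
  obtain ⟨l, rfl, hl⟩ := exists_ofWord_eq_and_length_eq g
  rw [List.length_eq_zero_iff.1 (hl.trans h), ofWord_nil]

theorem wordLength_letter_le (s : Letter V) : wordLength (letter Γ s) ≤ 1 :=
  wordLength_ofWord_le [s]

theorem exists_shorter_word (l : List (Letter V)) {s : Letter V} (h : StartsWith s (ofWord Γ l)) :
    ∃ l' : List (Letter V), l'.length < l.length ∧ ofWord Γ l' = (letter Γ s)⁻¹ * ofWord Γ l := by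
  induction l generalizing s with
  | nil => exact absurd h (not_startsWith_one s)
  | cons t l ih =>
    rw [ofWord_cons] at h ⊢
    rcases eq_or_ne t s with rfl | hts
    · exact ⟨l, by simp, by rw [inv_mul_cancel_left]⟩
    by_cases hadj : Γ.Adj t.1 s.1
    · obtain ⟨l', hlen, hl'⟩ := ih ((startsWith_letter_mul_of_adj hadj).1 h)
      refine ⟨t :: l', by simpa using hlen, ?_⟩
      rw [ofWord_cons, hl', ← mul_assoc, ← mul_assoc, (letter_commute hadj).inv_right.eq]
    · have ht : ¬ StartsWith t (letter Γ t * ofWord Γ l) := fun ht =>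
        (ht.eq_or_adj h).elim hts.symm hadj
      obtain ⟨l', hlen, hl'⟩ := ih (by rwa [startsWith_letter_mul, not_not] at ht)
      refine ⟨s.inv :: l', by simp only [List.length_cons]; omega, ?_⟩
      rw [ofWord_cons, hl', letter_inv, letter_inv, inv_inv]

theorem StartsWith.wordLength_letter_inv_mul {s : Letter V} {g : RAAG Γ} (h : StartsWith s g) :
    wordLength ((letter Γ s)⁻¹ * g) + 1 = wordLength g := by
  have hle : wordLength g ≤ wordLength (letter Γ s) + wordLength ((letter Γ s)⁻¹ * g) := by
    simpa only [mul_inv_cancel_left] using wordLength_mul_le (letter Γ s) ((letter Γ s)⁻¹ * g)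
  have hone := wordLength_letter_le (Γ := Γ) s
  obtain ⟨l, rfl, hl⟩ := exists_ofWord_eq_and_length_eq g
  obtain ⟨l', hlen, hl'⟩ := exists_shorter_word l h
  have := hl' ▸ wordLength_ofWord_le l'
  omega

theorem wordLength_letter_mul {s : Letter V} {g : RAAG Γ} (h : ¬ StartsWith s.inv g) :
    wordLength (letter Γ s * g) = wordLength g + 1 := by
  simpa only [inv_mul_cancel_left, eq_comm] using
    (startsWith_letter_mul.2 h).wordLength_letter_inv_mul

theorem startsWith_iff_wordLength_lt {s : Letter V} {g : RAAG Γ} :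
    StartsWith s g ↔ wordLength ((letter Γ s)⁻¹ * g) < wordLength g := by
  refine ⟨fun h => by have := h.wordLength_letter_inv_mul; omega, fun hlt => ?_⟩
  by_contra hs
  have := wordLength_letter_mul (s := s.inv) (g := g) (by rwa [s.inv_inv])
  rw [letter_inv] at this
  omega

theorem exists_startsWith {g : RAAG Γ} (hg : g ≠ 1) : ∃ s, StartsWith s g := by
  obtain ⟨_ | ⟨s, l⟩, rfl, hl⟩ := exists_ofWord_eq_and_length_eq g
  · exact absurd ofWord_nil hg
  · refine ⟨s, startsWith_iff_wordLength_lt.2 ?_⟩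
    rw [← hl, ofWord_cons, inv_mul_cancel_left]
    exact Nat.lt_succ_of_le (wordLength_ofWord_le l)

@[elab_as_elim]
theorem reducedWord_induction {motive : RAAG Γ → Prop} (one : motive 1)
    (letter_mul : ∀ s g, ¬ StartsWith s.inv g → motive g → motive (letter Γ s * g))
    (g : RAAG Γ) : motive g := by
  induction hn : wordLength g generalizing g with
  | zero => exact eq_one_of_wordLength_eq_zero hn ▸ one
  | succ n ih =>
    obtain ⟨s, hs⟩ := exists_startsWith (g := g) (by rintro rfl; simp at hn)
    have hlen := hs.wordLength_letter_inv_mul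
    have := letter_mul s _ (not_startsWith_inv_letter_inv_mul.2 hs) (ih _ (by omega))
    rwa [mul_inv_cancel_left] at this

/-- There is no cancellation in the product `g * h`. -/
def IsReducedMul (g h : RAAG Γ) : Prop := wordLength (g * h) = wordLength g + wordLength h

theorem isReducedMul_one_left (g : RAAG Γ) : IsReducedMul 1 g := by simp [IsReducedMul]

theorem isReducedMul_letter_iff {s : Letter V} {g : RAAG Γ} :
    IsReducedMul (letter Γ s) g ↔ ¬ StartsWith s.inv g := by
  have hone : wordLength (letter Γ s) = 1 := by
    simpa using (startsWith_letter (Γ := Γ) s).wordLength_letter_inv_mul.symm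
  rw [IsReducedMul, hone]
  refine ⟨fun h hs => ?_, fun h => by rw [wordLength_letter_mul h, add_comm]⟩
  have := hs.wordLength_letter_inv_mul
  rw [letter_inv, inv_inv] at this
  omega

namespace IsReducedMul

variable {g h k : RAAG Γ}

theorem startsWith (hgh : IsReducedMul g h) {s : Letter V} (hs : StartsWith s g) :
    StartsWith s (g * h) := by
  rw [startsWith_iff_wordLength_lt, hgh, ← mul_assoc]
  have := wordLength_mul_le ((letter Γ s)⁻¹ * g) h
  have := hs.wordLength_letter_inv_mul
  omega

protected theorem inv (hgh : IsReducedMul g h) : IsReducedMul h⁻¹ g⁻¹ := by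
  rw [IsReducedMul, ← mul_inv_rev, wordLength_inv, wordLength_inv, wordLength_inv, hgh, add_comm]

theorem of_mul_left (h₁ : IsReducedMul (g * h) k) (h₂ : IsReducedMul g h) :
    IsReducedMul h k := by
  have hle := wordLength_mul_le g (h * k)
  have := wordLength_mul_le h k
  rw [← mul_assoc] at hle
  unfold IsReducedMul at *
  omega

theorem of_mul_right (h₁ : IsReducedMul g (h * k)) (h₂ : IsReducedMul h k) :
    IsReducedMul g h := by
  have hle := wordLength_mul_le (g * h) k
  have := wordLength_mul_le g h
  rw [mul_assoc] at hle
  unfold IsReducedMul at *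
  omega

theorem mul_left (h₁ : IsReducedMul g (h * k)) (h₂ : IsReducedMul h k) :
    IsReducedMul (g * h) k := by
  have := h₁.of_mul_right h₂
  unfold IsReducedMul at *
  rw [mul_assoc]
  omega

theorem not_startsWith_inv (hgh : IsReducedMul g h) {s : Letter V} (hs : StartsWith s h) :
    ¬ StartsWith s g⁻¹ := fun hs' => by
  have hle := wordLength_mul_le (g * letter Γ s) ((letter Γ s)⁻¹ * h)
  rw [mul_assoc, mul_inv_cancel_left, hgh, ← wordLength_inv (g * _), mul_inv_rev] at hle
  have := hs.wordLength_letter_inv_mul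
  have := hs'.wordLength_letter_inv_mul
  have := wordLength_inv g
  omega

end IsReducedMul

theorem isReducedMul_or_isReducedMul_letter_inv (g : RAAG Γ) (t : Letter V) :
    IsReducedMul g (letter Γ t) ∨ IsReducedMul (g * letter Γ t) (letter Γ t)⁻¹ := by
  by_cases h : StartsWith t g⁻¹
  · right
    simpa only [mul_inv_rev, inv_inv] using (isReducedMul_letter_iff (s := t)
      (g := (letter Γ t)⁻¹ * g⁻¹)).2 (not_startsWith_inv_letter_inv_mul.2 h) |>.inv
  · left
    simpa only [letter_inv, inv_inv] using (isReducedMul_letter_iff (s := t.inv)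
      (g := g⁻¹)).2 (by rwa [t.inv_inv]) |>.inv

@[elab_as_elim]
theorem reducedWord_reverse_induction {motive : RAAG Γ → Prop} (one : motive 1)
    (mul_letter : ∀ g s, IsReducedMul g (letter Γ s) → motive g → motive (g * letter Γ s))
    (g : RAAG Γ) : motive g := by
  rw [← inv_inv g]
  induction g⁻¹ using reducedWord_induction with
  | one => rwa [inv_one]
  | letter_mul s g hs ih =>
    rw [mul_inv_rev]
    exact mul_letter _ s.inv (isReducedMul_letter_iff.2 hs).inv ih

end Words

/-! ### Parabolic subgroups -/

section Parabolic

variable {V : Type u} {Γ : SimpleGraph V} {S : Set V} {s t : Letter V} {g h : RAAG Γ}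

/-- The standard parabolic subgroup generated by a set of vertices. -/
def parabolic (Γ : SimpleGraph V) (S : Set V) : Subgroup (RAAG Γ) :=
  Subgroup.closure (gen Γ '' S)

theorem gen_mem_parabolic {a : V} (ha : a ∈ S) : gen Γ a ∈ parabolic Γ S :=
  Subgroup.subset_closure ⟨a, ha, rfl⟩

theorem letter_mem_parabolic (hs : s.1 ∈ S) : letter Γ s ∈ parabolic Γ S := by
  rcases s with ⟨a, _ | _⟩
  · exact inv_mem (gen_mem_parabolic hs)
  · exact gen_mem_parabolic hs

theorem parabolic_mono {T : Set V} (hST : S ⊆ T) : parabolic Γ S ≤ parabolic Γ T :=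
  Subgroup.closure_mono (Set.image_mono hST)

theorem parabolic_univ : parabolic Γ Set.univ = ⊤ := by
  rw [parabolic, Set.image_univ]
  exact PresentedGroup.closure_range_of _

@[elab_as_elim]
theorem parabolic_induction {motive : ∀ g : RAAG Γ, g ∈ parabolic Γ S → Prop}
    (one : motive 1 (one_mem _))
    (letter_mul : ∀ (s : Letter V) (hs : s.1 ∈ S) (g : RAAG Γ) (hg : g ∈ parabolic Γ S),
      motive g hg → motive (letter Γ s * g) (mul_mem (letter_mem_parabolic hs) hg))
    (hg : g ∈ parabolic Γ S) : motive g hg := by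
  refine Subgroup.closure_induction_left one ?_ ?_ hg
  · rintro _ ⟨a, ha, rfl⟩ g hg ih
    exact letter_mul (a, true) ha g hg ih
  · rintro _ ⟨a, ha, rfl⟩ g hg ih
    exact letter_mul (a, false) ha g hg ih

theorem startsWith_parabolic_mul (hh : h ∈ parabolic Γ (Γ.neighborSet s.1)) :
    StartsWith s (h * g) ↔ StartsWith s g := by
  induction hh using parabolic_induction with
  | one => rw [one_mul]
  | letter_mul t ht h _ ih => rw [mul_assoc, startsWith_letter_mul_of_adj ht.symm, ih]

theorem commute_letter_of_mem_parabolic (hg : g ∈ parabolic Γ (Γ.neighborSet s.1)) :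
    Commute (letter Γ s) g := by
  induction hg using parabolic_induction with
  | one => exact .one_right _
  | letter_mul t ht g _ ih => exact (letter_commute ht).mul_right ih

theorem IsReducedMul.mem_parabolic_of_startsWith_mul (hgh : IsReducedMul g h)
    (hs : StartsWith s (g * h)) (hg : ¬ StartsWith s g) :
    g ∈ parabolic Γ (Γ.neighborSet s.1) ∧ StartsWith s h := by
  induction g using reducedWord_induction with
  | one => exact ⟨one_mem _, by rwa [one_mul] at hs⟩
  | letter_mul t g ht ih =>
    have htg : StartsWith t (letter Γ t * g) := startsWith_letter_mul.2 ht
    rcases (hgh.startsWith htg).eq_or_adj hs with rfl | hadj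
    · exact absurd htg hg
    rw [startsWith_letter_mul_of_adj hadj] at hg
    rw [mul_assoc, startsWith_letter_mul_of_adj hadj] at hs
    obtain ⟨hmem, hsh⟩ := ih (hgh.of_mul_left (isReducedMul_letter_iff.2 ht)) hs hg
    exact ⟨mul_mem (letter_mem_parabolic hadj.symm) hmem, hsh⟩

theorem isReducedMul_of_forall_not_startsWith (hgh : ∀ s, StartsWith s g⁻¹ → ¬ StartsWith s h) :
    IsReducedMul g h := by
  induction g using reducedWord_induction with
  | one => exact isReducedMul_one_left h
  | letter_mul t g ht ih =>
    have hred : IsReducedMul (letter Γ t) g := isReducedMul_letter_iff.2 ht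
    have hgh' : IsReducedMul g h := ih fun s hs => hgh s (by
      simpa only [mul_inv_rev] using hred.inv.startsWith hs)
    refine (isReducedMul_letter_iff.2 fun hs => ?_).mul_left hgh'
    -- Otherwise `t⁻¹` moves through `g` to the beginning of `h`, where it meets the letter `t`.
    obtain ⟨hg, hsh⟩ := hgh'.mem_parabolic_of_startsWith_mul hs ht
    refine hgh t.inv ?_ hsh
    have hcomm : Commute (letter Γ t) g := commute_letter_of_mem_parabolic hg
    rw [hcomm.eq, mul_inv_rev, startsWith_inv_letter_inv_mul, ← mul_one g⁻¹,
      startsWith_parabolic_mul (s := t) (inv_mem hg)]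
    exact not_startsWith_one t

theorem eq_and_mem_parabolic_of_startsWith_mul_letter (hg : ¬ StartsWith s g)
    (hgt : StartsWith s (g * letter Γ t)) :
    s = t ∧ g ∈ parabolic Γ (Γ.neighborSet s.1) := by
  rcases isReducedMul_or_isReducedMul_letter_inv g t with hred | hred
  · obtain ⟨hmem, hst⟩ := hred.mem_parabolic_of_startsWith_mul hgt hg
    exact ⟨startsWith_letter_iff.1 hst, hmem⟩
  · have := hred.startsWith hgt
    rw [mul_inv_cancel_right] at this
    exact absurd this hg

theorem startsWith_mul_letter (hst : s.1 ≠ t.1) :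
    StartsWith s (g * letter Γ t) ↔ StartsWith s g := by
  constructor <;> intro hs <;> by_contra hs'
  · exact hst (congrArg Prod.fst (eq_and_mem_parabolic_of_startsWith_mul_letter hs' hs).1)
  · rw [← mul_inv_cancel_right g (letter Γ t), ← letter_inv] at hs
    exact hst (congrArg Prod.fst (eq_and_mem_parabolic_of_startsWith_mul_letter hs' hs).1 :)

theorem startsWith_mul_parabolic (hs : s.1 ∉ S) (hh : h ∈ parabolic Γ S) :
    StartsWith s (g * h) ↔ StartsWith s g := by
  induction hh using parabolic_induction generalizing g with
  | one => rw [mul_one]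
  | letter_mul t ht h _ ih =>
    rw [← mul_assoc, ih, startsWith_mul_letter (ne_of_mem_of_not_mem ht hs).symm]

theorem StartsWith.fst_mem_of_mem_parabolic (hs : StartsWith s g) (hg : g ∈ parabolic Γ S) :
    s.1 ∈ S := by
  by_contra hsS
  rw [← one_mul g, startsWith_mul_parabolic hsS hg] at hs
  exact not_startsWith_one s hs

theorem parabolic_iInter {ι : Sort*} (S : ι → Set V) :
    parabolic Γ (⋂ i, S i) = ⨅ i, parabolic Γ (S i) := by
  refine le_antisymm (le_iInf fun i => parabolic_mono (Set.iInter_subset S i)) fun g hg => ?_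
  rw [Subgroup.mem_iInf] at hg
  induction g using reducedWord_induction with
  | one => exact one_mem _
  | letter_mul s g hs ih =>
    have hsS : ∀ i, s.1 ∈ S i := fun i =>
      (startsWith_letter_mul.2 hs).fst_mem_of_mem_parabolic (hg i)
    refine mul_mem (letter_mem_parabolic (Set.mem_iInter.2 hsS)) (ih fun i => ?_)
    exact ((parabolic Γ (S i)).mul_mem_cancel_left (letter_mem_parabolic (hsS i))).1 (hg i)

theorem commute_gen_of_mem_parabolic_star {a : V} (hg : g ∈ parabolic Γ (star Γ a)) :
    Commute g (gen Γ a) := by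
  induction hg using parabolic_induction with
  | one => exact .one_left _
  | letter_mul s hs g _ ih =>
    refine .mul_left ?_ ih
    rcases hs with rfl | hadj
    · rcases s with ⟨a, _ | _⟩
      · exact (Commute.refl (gen Γ a)).inv_left
      · exact .refl _
    · exact letter_commute (t := (a, true)) hadj.symm

theorem mem_parabolic_star_of_commute {a : V} (hg : Commute g (gen Γ a)) :
    g ∈ parabolic Γ (star Γ a) := by
  induction g using reducedWord_induction with
  | one => exact one_mem _
  | letter_mul s g hs ih =>
    have hsg : StartsWith s (letter Γ s * g) := startsWith_letter_mul.2 hs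
    suffices hmem : s.1 ∈ star Γ a by
      have hcomm := commute_gen_of_mem_parabolic_star (letter_mem_parabolic (Γ := Γ) hmem)
      refine mul_mem (letter_mem_parabolic hmem) (ih ?_)
      simpa only [inv_mul_cancel_left] using hcomm.inv_left.mul_left hg
    have fst_mem : ∀ b, StartsWith (a, b) (letter Γ s * g) → s.1 ∈ star Γ a := fun b hb =>
      (hb.eq_or_adj hsg).imp (congrArg Prod.fst) id
    by_contra hmem
    have hag : StartsWith (a, true) (gen Γ a * (letter Γ s * g)) :=
      startsWith_letter_mul.2 (mt (fst_mem false) hmem)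
    have hsg' : StartsWith s (gen Γ a * (letter Γ s * g)) := by
      rw [← hg.eq]
      exact (startsWith_mul_letter (t := (a, true)) fun h => hmem (.inl h)).2 hsg
    exact hmem ((hag.eq_or_adj hsg').imp (congrArg Prod.fst) id)

open Classical in
/-- The retraction of `A_Γ` onto a standard parabolic subgroup, killing the other vertices. -/
noncomputable def retract (Γ : SimpleGraph V) (S : Set V) : RAAG Γ →* RAAG Γ :=
  lift (fun a => if a ∈ S then gen Γ a else 1) fun a b hab => by
    split_ifs <;> simp [gen_commute hab]

theorem retract_gen_of_mem {a : V} (ha : a ∈ S) : retract Γ S (gen Γ a) = gen Γ a := by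
  rw [retract, lift_gen, if_pos ha]

theorem retract_mem (S : Set V) (g : RAAG Γ) : retract Γ S g ∈ parabolic Γ S := by
  have hle : parabolic Γ Set.univ ≤ (parabolic Γ S).comap (retract Γ S) := by
    rw [parabolic, Subgroup.closure_le]
    rintro _ ⟨a, -, rfl⟩
    rw [SetLike.mem_coe, Subgroup.mem_comap, retract, lift_gen]
    split_ifs with ha
    · exact gen_mem_parabolic ha
    · exact one_mem _
  exact hle (parabolic_univ ▸ Subgroup.mem_top g)

theorem retract_of_mem (hg : g ∈ parabolic Γ S) : retract Γ S g = g := by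
  have hle : parabolic Γ S ≤ (retract Γ S).eqLocus (MonoidHom.id _) := by
    rw [parabolic, Subgroup.closure_le]
    rintro _ ⟨a, ha, rfl⟩
    exact retract_gen_of_mem ha
  exact hle hg

theorem exists_common_conj {a b : V} (hab : Γ.Adj a b) {x y : RAAG Γ}
    (hx : x = g * gen Γ a * g⁻¹) (hy : IsConj (gen Γ b) y) (hxy : Commute x y) :
    ∃ c ∈ parabolic Γ (star Γ a), x = (g * c) * gen Γ a * (g * c)⁻¹ ∧
      y = (g * c) * gen Γ b * (g * c)⁻¹ := by
  have hmem : g⁻¹ * y * g ∈ parabolic Γ (star Γ a) := by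
    refine mem_parabolic_star_of_commute ?_
    have := (Commute.conj_iff g⁻¹).2 hxy.symm
    simpa only [hx, inv_inv, mul_assoc, inv_mul_cancel_left, inv_mul_cancel, mul_one] using this
  obtain ⟨k, rfl⟩ := isConj_iff.1 hy
  have hret := retract_of_mem hmem
  rw [show g⁻¹ * (k * gen Γ b * k⁻¹) * g = (g⁻¹ * k) * gen Γ b * (g⁻¹ * k)⁻¹ by group, map_mul,
    map_mul, map_inv, retract_gen_of_mem (show b ∈ star Γ a from .inr hab)] at hret
  have hc := retract_mem (star Γ a) (g⁻¹ * k)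
  refine ⟨_, hc, ?_, ?_⟩
  · rw [hx, mul_assoc g (retract _ _ _), (commute_gen_of_mem_parabolic_star hc).eq]
    group
  · rw [mul_inv_rev, ← mul_assoc, mul_assoc g, mul_assoc g, hret]
    group

end Parabolic

/-! ### Half-spaces -/

section Halfspace

open scoped Pointwise

variable {V : Type u} {Γ : SimpleGraph V} {S : Set V} {s t : Letter V} {g h x z : RAAG Γ}

/-- The half-space of the Cayley graph bounded by the wall between `g` and `g * s` that contains
`g * s`. -/
def halfspace (g : RAAG Γ) (s : Letter V) : Set (RAAG Γ) := {z | StartsWith s (g⁻¹ * z)}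

theorem mem_halfspace : z ∈ halfspace g s ↔ StartsWith s (g⁻¹ * z) := Iff.rfl

theorem smul_halfspace (x g : RAAG Γ) (s : Letter V) : x • halfspace g s = halfspace (x * g) s := by
  ext z
  rw [Set.mem_smul_set_iff_inv_smul_mem, mem_halfspace, mem_halfspace, smul_eq_mul, mul_inv_rev,
    mul_assoc]

theorem compl_halfspace (g : RAAG Γ) (s : Letter V) :
    (halfspace g s)ᶜ = halfspace (g * letter Γ s) s.inv := by
  ext z
  rw [Set.mem_compl_iff, mem_halfspace, mem_halfspace, mul_inv_rev, mul_assoc,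
    startsWith_inv_letter_inv_mul]

theorem halfspace_mul_parabolic (hh : h ∈ parabolic Γ (Γ.neighborSet s.1)) (g : RAAG Γ) :
    halfspace (g * h) s = halfspace g s := by
  ext z
  rw [mem_halfspace, mem_halfspace, mul_inv_rev, mul_assoc, startsWith_parabolic_mul (inv_mem hh)]

theorem notMem_halfspace_self (g : RAAG Γ) (s : Letter V) : g ∉ halfspace g s := by
  rw [mem_halfspace, inv_mul_cancel]
  exact not_startsWith_one s

theorem mul_mem_halfspace (h : StartsWith s z) (g : RAAG Γ) : g * z ∈ halfspace g s := by
  rwa [mem_halfspace, inv_mul_cancel_left]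

theorem mul_letter_mem_halfspace (g : RAAG Γ) (s : Letter V) : g * letter Γ s ∈ halfspace g s :=
  mul_mem_halfspace (startsWith_letter s) g

theorem mul_parabolic_mem_halfspace_iff (hs : s.1 ∉ S) (hh : h ∈ parabolic Γ S) :
    z * h ∈ halfspace g s ↔ z ∈ halfspace g s := by
  rw [mem_halfspace, mem_halfspace, ← mul_assoc, startsWith_mul_parabolic hs hh]

theorem eq_and_mem_parabolic_of_mul_letter_mem_halfspace (hz : z ∉ halfspace g s)
    (hzt : z * letter Γ t ∈ halfspace g s) :
    s = t ∧ g⁻¹ * z ∈ parabolic Γ (Γ.neighborSet s.1) :=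
  eq_and_mem_parabolic_of_startsWith_mul_letter hz (by rwa [mem_halfspace, ← mul_assoc] at hzt)

theorem conj_mem_parabolic_of_smul_halfspace_eq (h : x • halfspace g s = halfspace g s) :
    g⁻¹ * x * g ∈ parabolic Γ (Γ.neighborSet s.1) := by
  rw [smul_halfspace] at h
  rw [mul_assoc]
  exact (eq_and_mem_parabolic_of_mul_letter_mem_halfspace (h ▸ notMem_halfspace_self (x * g) s)
    (h ▸ mul_letter_mem_halfspace (x * g) s)).2

/-- The half-spaces bounded by the walls that separate `g` from `g * a`, for some `g`. -/
def halfspaces (Γ : SimpleGraph V) (a : V) : Set (Set (RAAG Γ)) :=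
  {K | ∃ g s, s.1 = a ∧ K = halfspace g s}

theorem halfspace_mem_halfspaces (g : RAAG Γ) (s : Letter V) :
    halfspace g s ∈ halfspaces Γ s.1 := ⟨g, s, rfl, rfl⟩

theorem smul_mem_halfspaces {a : V} {K : Set (RAAG Γ)} (hK : K ∈ halfspaces Γ a) (x : RAAG Γ) :
    x • K ∈ halfspaces Γ a := by
  obtain ⟨g, s, rfl, rfl⟩ := hK
  exact smul_halfspace x g s ▸ halfspace_mem_halfspaces (x * g) s

theorem mul_parabolic_mem_iff {a : V} {K : Set (RAAG Γ)} (hK : K ∈ halfspaces Γ a) (ha : a ∉ S)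
    (hh : h ∈ parabolic Γ S) : z * h ∈ K ↔ z ∈ K := by
  obtain ⟨g, s, rfl, rfl⟩ := hK
  exact mul_parabolic_mem_halfspace_iff ha hh

theorem finite_separating_halfspaces (a : V) (x y : RAAG Γ) :
    {K ∈ halfspaces Γ a | x ∈ K ∧ y ∉ K}.Finite := by
  suffices ∀ z, {K ∈ halfspaces Γ a | y * z ∈ K ∧ y ∉ K}.Finite by
    simpa only [mul_inv_cancel_left] using this (y⁻¹ * x)
  intro z
  induction z using reducedWord_reverse_induction with
  | one => simp
  | mul_letter z t _ ih =>
    refine (ih.union (Set.finite_singleton (halfspace (y * z) t))).subset ?_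
    rintro _ ⟨⟨g, s, rfl, rfl⟩, hyzt, hy⟩
    by_cases hyz : y * z ∈ halfspace g s
    · exact .inl ⟨halfspace_mem_halfspaces g s, hyz, hy⟩
    · rw [← mul_assoc] at hyzt
      obtain ⟨rfl, hmem⟩ := eq_and_mem_parabolic_of_mul_letter_mem_halfspace hyz hyzt
      refine .inr ?_
      rw [Set.mem_singleton_iff, ← halfspace_mul_parabolic hmem g, mul_inv_cancel_left]

/-- Half-spaces are connected in the Cayley graph: a predicate that is constant along the edges of a
half-space is constant. -/
theorem halfspace_connected {Q : RAAG Γ → Prop}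
    (hQ : ∀ z t, z ∈ halfspace g s → z * letter Γ t ∈ halfspace g s →
      (Q z ↔ Q (z * letter Γ t))) (hz : z ∈ halfspace g s) : Q z ↔ Q (g * letter Γ s) := by
  have hred : IsReducedMul (letter Γ s) ((letter Γ s)⁻¹ * (g⁻¹ * z)) :=
    isReducedMul_letter_iff.2 (not_startsWith_inv_letter_inv_mul.2 hz)
  rw [show z = g * letter Γ s * ((letter Γ s)⁻¹ * (g⁻¹ * z)) by group]
  generalize (letter Γ s)⁻¹ * (g⁻¹ * z) = m at hred
  induction m using reducedWord_reverse_induction with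
  | one => rw [mul_one]
  | mul_letter m t hmt ih =>
    have hsm := hred.of_mul_right hmt
    have mem : ∀ {m}, IsReducedMul (letter Γ s) m → g * letter Γ s * m ∈ halfspace g s :=
      fun hm => mul_assoc g _ _ ▸ mul_mem_halfspace (hm.startsWith (startsWith_letter s)) g
    rw [← mul_assoc]
    exact (hQ _ t (mem hsm) (mul_assoc _ m _ ▸ mem hred)).symm.trans (ih hsm)

theorem halfspace_subset_or_subset_compl {g' : RAAG Γ} (hadj : ¬ Γ.Adj t.1 s.1)
    (hwall : ¬ (g' ∈ halfspace g s ∧ g' * letter Γ t ∈ halfspace g s)) :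
    halfspace g s ⊆ halfspace g' t ∨ halfspace g s ⊆ (halfspace g' t)ᶜ := by
  have not_cross : ∀ z r, z ∈ halfspace g s → z * letter Γ r ∈ halfspace g s →
      z * letter Γ r ∈ halfspace g' t → z ∈ halfspace g' t := by
    intro z r hz hzr hzr'
    by_contra hz'
    obtain ⟨rfl, hmem⟩ := eq_and_mem_parabolic_of_mul_letter_mem_halfspace hz' hzr'
    refine hwall ⟨(mul_parabolic_mem_halfspace_iff hadj hmem).1 (by rwa [mul_inv_cancel_left]),
      (mul_parabolic_mem_halfspace_iff hadj hmem).1 ?_⟩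
    rwa [mul_assoc, (commute_letter_of_mem_parabolic hmem).eq, ← mul_assoc, mul_inv_cancel_left]
  have same_side : ∀ z ∈ halfspace g s,
      (z ∈ halfspace g' t ↔ g * letter Γ s ∈ halfspace g' t) := fun z hz =>
    halfspace_connected (Q := (· ∈ halfspace g' t)) (fun z r hz hzr =>
      ⟨fun hz' => not_cross _ r.inv hzr (by rwa [letter_inv, mul_inv_cancel_right])
        (by rwa [letter_inv, mul_inv_cancel_right]), not_cross z r hz hzr⟩) hz
  by_cases hside : g * letter Γ s ∈ halfspace g' t
  · exact .inl fun z hz => (same_side z hz).2 hside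
  · exact .inr fun z hz hz' => hside ((same_side z hz).1 hz')

theorem halfspaces_nested {a b : V} (hadj : ¬ Γ.Adj b a) {K L : Set (RAAG Γ)}
    (hK : K ∈ halfspaces Γ a) (hL : L ∈ halfspaces Γ b) :
    K ⊆ L ∨ K ⊆ Lᶜ ∨ Kᶜ ⊆ L ∨ Kᶜ ⊆ Lᶜ := by
  obtain ⟨g, s, rfl, rfl⟩ := hK
  obtain ⟨g', t, rfl, rfl⟩ := hL
  by_cases hwall : g' ∈ halfspace g s ∧ g' * letter Γ t ∈ halfspace g s
  · have hwall' : ¬ (g' ∈ (halfspace g s)ᶜ ∧ g' * letter Γ t ∈ (halfspace g s)ᶜ) :=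
      fun h => h.1 hwall.1
    rw [compl_halfspace g s] at hwall' ⊢
    exact .inr (.inr (halfspace_subset_or_subset_compl (s := s.inv) hadj hwall'))
  · exact (halfspace_subset_or_subset_compl hadj hwall).imp_right .inl

end Halfspace

/-! ### Skewered half-spaces -/

section Skewer

open scoped Pointwise
open Filter

theorem zpow_smul_strictAnti {G α : Type*} [Group G] [MulAction G α] {x : G} {K : Set α}
    (hxK : x • K ⊂ K) : StrictAnti fun n : ℤ => x ^ n • K := by
  refine strictAnti_int_of_succ_lt fun n => ?_
  rw [zpow_add_one, mul_smul]
  exact (MulAction.injective (x ^ n)).image_strictMono hxK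

variable {V : Type u} {Γ : SimpleGraph V} {a : V} {x y z : RAAG Γ} {K L : Set (RAAG Γ)}

/-- No reduced word for `x` begins with a letter and ends with its inverse. -/
def IsCyclicallyReduced (x : RAAG Γ) : Prop := ∀ s, StartsWith s x → ¬ StartsWith s x⁻¹

theorem wordLength_conj_letter_lt {s : Letter V} (hx : StartsWith s x) (hx' : StartsWith s x⁻¹) :
    wordLength ((letter Γ s)⁻¹ * x * letter Γ s) < wordLength x := by
  have hs : StartsWith s (x⁻¹ * letter Γ s) := by
    by_contra hs
    rw [← mul_inv_cancel_right x⁻¹ (letter Γ s)] at hx'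
    exact s.inv_ne (eq_and_mem_parabolic_of_startsWith_mul_letter (t := s.inv) hs hx').1.symm
  have hlen := hs.wordLength_letter_inv_mul
  have hlen' := hx.wordLength_letter_inv_mul
  rw [← wordLength_inv, ← wordLength_inv (x⁻¹ * _)] at hlen
  simp only [mul_inv_rev, inv_inv] at hlen
  omega

theorem exists_isCyclicallyReduced_conj (x : RAAG Γ) :
    ∃ k y, IsCyclicallyReduced y ∧ x = k * y * k⁻¹ := by
  induction hn : wordLength x using Nat.strong_induction_on generalizing x with
  | _ n ih =>
    by_cases hx : IsCyclicallyReduced x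
    · exact ⟨1, x, hx, by group⟩
    · simp only [IsCyclicallyReduced, not_forall, not_not] at hx
      obtain ⟨s, hs, hs'⟩ := hx
      obtain ⟨k, y, hy, hky⟩ := ih _ (hn ▸ wordLength_conj_letter_lt hs hs') _ rfl
      refine ⟨letter Γ s * k, y, hy, ?_⟩
      rw [show letter Γ s * k * y * (letter Γ s * k)⁻¹ =
        letter Γ s * (k * y * k⁻¹) * (letter Γ s)⁻¹ by group, ← hky]
      group

theorem exists_reduced_factorization_of_notMem_parabolic (hx : x ∉ parabolic Γ {a}ᶜ) :
    ∃ g h s, x = g * h ∧ IsReducedMul g h ∧ s.1 = a ∧ StartsWith s h := by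
  induction x using reducedWord_induction with
  | one => exact absurd (one_mem _) hx
  | letter_mul t x ht ih =>
    by_cases hta : t.1 = a
    · exact ⟨1, _, t, (one_mul _).symm, isReducedMul_one_left _, hta, startsWith_letter_mul.2 ht⟩
    · obtain ⟨g, h, s, rfl, hgh, hs⟩ := ih (mt (mul_mem (letter_mem_parabolic hta)) hx)
      exact ⟨letter Γ t * g, h, s, (mul_assoc _ _ _).symm,
        (isReducedMul_letter_iff.2 ht).mul_left hgh, hs⟩

theorem IsCyclicallyReduced.exists_smul_ssubset (hx : IsCyclicallyReduced x)
    (hxa : x ∉ parabolic Γ {a}ᶜ) : ∃ K ∈ halfspaces Γ a, x • K ⊂ K := by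
  have hxx : IsReducedMul x x :=
    isReducedMul_of_forall_not_startsWith fun s hs hs' => hx s hs' hs
  obtain ⟨g, h, s, hgh_eq, hgh, rfl, hs⟩ := exists_reduced_factorization_of_notMem_parabolic hxa
  have hg : ¬ StartsWith s g⁻¹ := hgh.not_startsWith_inv hs
  have one_notMem : (1 : RAAG Γ) ∉ halfspace g s := by rwa [mem_halfspace, mul_one]
  have mem : x ∈ halfspace g s := hgh_eq ▸ mul_mem_halfspace hs g
  have sq_mem : x * x ∈ halfspace g s := by
    have hhx : IsReducedMul h x := IsReducedMul.of_mul_left (hgh_eq ▸ hxx) hgh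
    nth_rw 1 [hgh_eq]
    rw [mul_assoc]
    exact mul_mem_halfspace (hhx.startsWith hs) g
  have inv_notMem : x⁻¹ ∉ halfspace g s := fun hinv => by
    have hxg : IsReducedMul x g := IsReducedMul.of_mul_right (hgh_eq ▸ hxx) hgh
    obtain ⟨hmem, hsx⟩ := hxg.inv.mem_parabolic_of_startsWith_mul hinv hg
    refine hx s ?_ hsx
    rwa [hgh_eq, startsWith_parabolic_mul (by simpa using hmem)]
  have notMem_smul : x ∉ x • halfspace g s := by
    rwa [Set.mem_smul_set_iff_inv_smul_mem, smul_eq_mul, inv_mul_cancel]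
  have hK := halfspace_mem_halfspaces g s
  refine ⟨_, hK, ?_, fun hle => notMem_smul (hle mem)⟩
  rcases halfspaces_nested (Γ.irrefl (v := s.1)) (smul_mem_halfspaces hK x) hK with
    hle | hle | hle | hle
  · exact hle
  · exact absurd sq_mem (hle ⟨x, mem, rfl⟩)
  · refine absurd (hle ?_) one_notMem
    rwa [Set.mem_compl_iff, Set.mem_smul_set_iff_inv_smul_mem, smul_eq_mul, mul_one]
  · exact absurd mem (hle notMem_smul)

theorem exists_ne_smul_eq_of_separating (hK : K ∈ halfspaces Γ a) {f : ℕ → RAAG Γ}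
    (hy : ∀ n, y ∈ f n • K) (hz : ∀ n, z ∉ f n • K) : ∃ m n, m ≠ n ∧ f m • K = f n • K := by
  have := (finite_separating_halfspaces a y z).to_subtype
  obtain ⟨m, n, hmn, heq⟩ := Finite.exists_ne_map_eq_of_infinite fun n =>
    (⟨f n • K, smul_mem_halfspaces hK (f n), hy n, hz n⟩ :
      {K ∈ halfspaces Γ a | y ∈ K ∧ z ∉ K})
  exact ⟨m, n, hmn, congrArg Subtype.val heq⟩

theorem exists_conj_mem_parabolic_of_separating (hK : K ∈ halfspaces Γ a) {f : ℕ → RAAG Γ}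
    (hy : ∀ n, y ∈ f n • K) (hz : ∀ n, z ∉ f n • K) :
    ∃ m n g, m ≠ n ∧ g⁻¹ * ((f m)⁻¹ * f n) * g ∈ parabolic Γ (Γ.neighborSet a) := by
  obtain ⟨m, n, hmn, heq⟩ := exists_ne_smul_eq_of_separating hK hy hz
  obtain ⟨g, s, rfl, rfl⟩ := hK
  refine ⟨m, n, g, hmn, conj_mem_parabolic_of_smul_halfspace_eq ?_⟩
  rw [mul_smul, ← heq, inv_smul_smul]

theorem eventually_mem_zpow_smul (hK : K ∈ halfspaces Γ a) (hxK : x • K ⊂ K) (y : RAAG Γ) :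
    ∀ᶠ n : ℤ in atBot, y ∈ x ^ n • K := by
  have hanti := zpow_smul_strictAnti hxK
  suffices ∃ n : ℤ, y ∈ x ^ n • K from
    this.elim fun n hn => eventually_atBot.2 ⟨n, fun m hm => hanti.antitone hm hn⟩
  by_contra! hy
  obtain ⟨z, hz, -⟩ := Set.exists_of_ssubset hxK
  obtain ⟨m, n, hmn, heq⟩ := exists_ne_smul_eq_of_separating hK (f := fun n => x ^ (-n : ℤ))
    (y := z) (fun n => hanti.antitone (by omega : (-n : ℤ) ≤ 0) (by simpa using hz)) fun n => hy _
  have := hanti.injective heq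
  omega

theorem eventually_notMem_zpow_smul (hK : K ∈ halfspaces Γ a) (hxK : x • K ⊂ K) (y : RAAG Γ) :
    ∀ᶠ n : ℤ in atTop, y ∉ x ^ n • K := by
  have hanti := zpow_smul_strictAnti hxK
  suffices ∃ n : ℤ, y ∉ x ^ n • K from
    this.elim fun n hn => eventually_atTop.2 ⟨n, fun m hm =>
      mt (fun hm' => hanti.antitone hm hm') hn⟩
  by_contra! hy
  obtain ⟨z, -, hz⟩ := Set.exists_of_ssubset hxK
  obtain ⟨m, n, hmn, heq⟩ := exists_ne_smul_eq_of_separating hK (f := fun n => x ^ (n + 1 : ℤ))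
    (z := z) (fun _ => hy _) fun n =>
      mt (fun hn => hanti.antitone (by omega : (1 : ℤ) ≤ n + 1) hn) (by simpa using hz)
  have := hanti.injective heq
  omega

theorem subset_or_subset_of_smul_ssubset (hK : K ∈ halfspaces Γ a) (hL : L ∈ halfspaces Γ a)
    (hxK : x • K ⊂ K) (hxL : x • L ⊂ L) : K ⊆ L ∨ L ⊆ K := by
  rcases halfspaces_nested (Γ.irrefl (v := a)) hK hL with hle | hle | hle | hle
  · exact .inl hle
  · obtain ⟨n, hnK, hnL⟩ :=
      ((eventually_mem_zpow_smul hK hxK 1).and (eventually_mem_zpow_smul hL hxL 1)).exists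
    rw [Set.mem_smul_set_iff_inv_smul_mem] at hnK hnL
    exact absurd hnL (hle hnK)
  · obtain ⟨n, hnK, hnL⟩ :=
      ((eventually_notMem_zpow_smul hK hxK 1).and (eventually_notMem_zpow_smul hL hxL 1)).exists
    rw [Set.mem_smul_set_iff_inv_smul_mem] at hnK hnL
    exact absurd (hle hnK) hnL
  · exact .inr (Set.compl_subset_compl.1 hle)

theorem exists_zpow_smul_subset_subset (hK : K ∈ halfspaces Γ a) (hL : L ∈ halfspaces Γ a)
    (hxK : x • K ⊂ K) (hxL : x • L ⊂ L) :
    ∃ n : ℤ, x ^ (n + 1) • K ⊆ L ∧ L ⊆ x ^ n • K := by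
  have hanti := zpow_smul_strictAnti hxK
  have comparable : ∀ n : ℤ, x ^ n • K ⊆ L ∨ L ⊆ x ^ n • K := fun n => by
    refine subset_or_subset_of_smul_ssubset (smul_mem_halfspaces hK _) hL ?_ hxL
    rw [← mul_smul, ← zpow_one_add, add_comm]
    exact hanti (lt_add_one n)
  obtain ⟨y, hy, hy'⟩ := Set.exists_of_ssubset hxL
  rw [Set.mem_smul_set_iff_inv_smul_mem] at hy'
  obtain ⟨m, hm⟩ := (eventually_mem_zpow_smul hK hxK (x⁻¹ • y)).exists
  obtain ⟨M, hM⟩ := (eventually_notMem_zpow_smul hK hxK y).exists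
  obtain ⟨n, hn, hmax⟩ := Int.exists_greatest_of_bdd (P := fun n => L ⊆ x ^ n • K)
    ⟨M, fun n hn => not_lt.1 fun hMn => hM (hanti.antitone hMn.le (hn hy))⟩
    ⟨m, (comparable m).resolve_left fun hle => hy' (hle hm)⟩
  exact ⟨n, (comparable (n + 1)).resolve_right fun hle => (hmax _ hle).not_gt (lt_add_one n), hn⟩

theorem exists_zpow_mul_zpow_conj_mem_parabolic (hK : K ∈ halfspaces Γ a) (hxK : x • K ⊂ K)
    (hxy : Commute x y) :
    ∃ (m n : ℤ) (g : RAAG Γ), n ≠ 0 ∧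
      g⁻¹ * (x ^ m * y ^ n) * g ∈ parabolic Γ (Γ.neighborSet a) := by
  have skewers : ∀ n : ℕ, x • y ^ n • K ⊂ y ^ n • K := fun n => by
    rw [← mul_smul, (hxy.pow_right n).eq, mul_smul]
    exact (MulAction.injective (y ^ n)).image_strictMono hxK
  choose j hlow hhigh using fun n : ℕ => exists_zpow_smul_subset_subset hK
    (smul_mem_halfspaces hK (y ^ n)) hxK (skewers n)
  obtain ⟨p, hp, hp'⟩ := Set.exists_of_ssubset hxK
  rw [Set.mem_smul_set_iff_inv_smul_mem] at hp'
  obtain ⟨m, n, g, hmn, hg⟩ := exists_conj_mem_parabolic_of_separating hK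
    (f := fun n => x ^ (-j n) * y ^ n) (y := x • p) (z := x⁻¹ • p)
    (fun n => by
      rw [mul_smul, zpow_neg, Set.mem_inv_smul_set_iff, ← mul_smul, ← zpow_add_one]
      exact hlow n ⟨p, hp, rfl⟩)
    (fun n hn => by
      rw [mul_smul, zpow_neg, Set.mem_inv_smul_set_iff] at hn
      exact hp' (Set.smul_mem_smul_set_iff.1 (hhigh n hn)))
  refine ⟨j m - j n, n - m, g, by omega, ?_⟩
  convert hg using 3
  calc x ^ (j m - j n) * y ^ (n - m : ℤ)
      = y ^ (-m : ℤ) * x ^ (j m - j n) * y ^ (n : ℤ) := by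
        rw [← (hxy.zpow_zpow _ _).eq, mul_assoc, ← zpow_add, neg_add_eq_sub]
    _ = (x ^ (-j m) * y ^ m)⁻¹ * (x ^ (-j n) * y ^ n) := by group

theorem exists_zpow_conj_mem_parabolic {k : RAAG Γ} (hx : x ∈ parabolic Γ {a}ᶜ)
    (hkx : k⁻¹ * x * k ∈ parabolic Γ {a}ᶜ) (hk : k ∉ parabolic Γ {a}ᶜ) :
    ∃ (n : ℤ) (g : RAAG Γ), n ≠ 0 ∧ g⁻¹ * x ^ n * g ∈ parabolic Γ (Γ.neighborSet a) := by
  obtain ⟨b, h, s, rfl, hbh, rfl, hs⟩ := exists_reduced_factorization_of_notMem_parabolic hk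
  have hK := halfspace_mem_halfspaces b s
  have one_notMem : (1 : RAAG Γ) ∉ halfspace b s := by
    rw [mem_halfspace, mul_one]
    exact hbh.not_startsWith_inv hs
  have conj_eq : SemiconjBy (b * h) ((b * h)⁻¹ * x * (b * h))⁻¹ x⁻¹ := by
    rw [SemiconjBy]
    group
  obtain ⟨m, n, g, hmn, hg⟩ := exists_conj_mem_parabolic_of_separating hK
    (f := fun n => x ^ n) (y := b * h) (z := 1)
    (fun n => by
      rw [Set.mem_smul_set_iff_inv_smul_mem, smul_eq_mul, ← inv_pow, ← (conj_eq.pow_right n).eq,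
        mul_parabolic_mem_iff hK (by simp) (pow_mem (inv_mem hkx) n)]
      exact mul_mem_halfspace hs b)
    (fun n => by
      rwa [Set.mem_smul_set_iff_inv_smul_mem, smul_eq_mul, mul_one, ← one_mul (x ^ n)⁻¹,
        mul_parabolic_mem_iff hK (by simp) (inv_mem (pow_mem hx n))])
  refine ⟨n - m, g, by omega, ?_⟩
  rwa [sub_eq_neg_add, zpow_add, zpow_neg, zpow_natCast, zpow_natCast]

end Skewer

/-! ### Conjugating automorphisms -/

section Conjugating

open scoped Pointwise

variable {V : Type u} {Γ : SimpleGraph V} {f : MulAut (RAAG Γ)} {a b : V} {C : Set V}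
  {K : Set (RAAG Γ)} {s t : Letter V} {x y : RAAG Γ}

theorem mem_star_comm : a ∈ star Γ b ↔ b ∈ star Γ a :=
  or_congr eq_comm (Γ.adj_comm b a)

theorem conj_mem_parabolic_neighborSet (hx : x ∈ parabolic Γ (star Γ a))
    (hy : y ∈ parabolic Γ (Γ.neighborSet a)) : x * y * x⁻¹ ∈ parabolic Γ (Γ.neighborSet a) := by
  induction hx using parabolic_induction with
  | one => simpa only [one_mul, inv_one, mul_one]
  | letter_mul s hs g _ ih =>
    rw [show letter Γ s * g * y * (letter Γ s * g)⁻¹ =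
      letter Γ s * (g * y * g⁻¹) * (letter Γ s)⁻¹ by group]
    rcases hs with hs | hs
    · rw [(commute_letter_of_mem_parabolic (s := s) (by rwa [hs])).eq, mul_inv_cancel_right]
      exact ih
    · exact mul_mem (mul_mem (letter_mem_parabolic hs) ih) (inv_mem (letter_mem_parabolic hs))

theorem inv_mul_mem_parabolic_star (h : x * gen Γ a * x⁻¹ = y * gen Γ a * y⁻¹) :
    x⁻¹ * y ∈ parabolic Γ (star Γ a) := by
  refine mem_parabolic_star_of_commute ?_
  calc x⁻¹ * y * gen Γ a = x⁻¹ * (y * gen Γ a * y⁻¹) * y := by group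
    _ = gen Γ a * (x⁻¹ * y) := by rw [← h]; group

theorem map_letter_eq_conj {F : Type*} [FunLike F (RAAG Γ) (RAAG Γ)]
    [MonoidHomClass F (RAAG Γ) (RAAG Γ)] {φ : F} (hφ : φ (gen Γ s.1) = x * gen Γ s.1 * x⁻¹) :
    φ (letter Γ s) = x * letter Γ s * x⁻¹ := by
  obtain ⟨a, _ | _⟩ := s
  · rw [letter_false, map_inv, hφ]
    group
  · exact hφ

section PingPong

variable {F : Type*} [FunLike F (RAAG Γ) (RAAG Γ)] [MonoidHomClass F (RAAG Γ) (RAAG Γ)] {φ : F}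
  {g : V → RAAG Γ}

theorem map_letter_mul_mem_halfspace_iff (hφ : ∀ a, φ (gen Γ a) = g a * gen Γ a * (g a)⁻¹)
    (hst : Γ.Adj s.1 t.1) (z : RAAG Γ) :
    φ (letter Γ t) * z ∈ halfspace (g s.1) s ↔ z ∈ halfspace (g s.1) s := by
  obtain ⟨c, hc, -, hconj⟩ := exists_common_conj hst (hφ s.1)
    (isConj_iff.2 ⟨g t.1, (hφ t.1).symm⟩) ((gen_commute hst).map φ)
  rw [map_letter_eq_conj hconj, mem_halfspace, mem_halfspace, ← startsWith_parabolic_mul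
    (conj_mem_parabolic_neighborSet hc (letter_mem_parabolic (Γ := Γ) hst)) (g := (g s.1)⁻¹ * z)]
  simp only [mul_assoc, mul_inv_rev, inv_mul_cancel_left]

theorem map_letter_mul_mem_halfspace (hφ : φ (gen Γ s.1) = x * gen Γ s.1 * x⁻¹) {z : RAAG Γ}
    (hz : z ∉ halfspace x s.inv) : φ (letter Γ s) * z ∈ halfspace x s := by
  rw [map_letter_eq_conj hφ, mem_halfspace,
    show x⁻¹ * (x * letter Γ s * x⁻¹ * z) = letter Γ s * (x⁻¹ * z) by group, startsWith_letter_mul]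
  exact hz

/-- Ping-pong: the first letter of `x` can be read off from the half-space containing `φ x`. -/
theorem startsWith_iff_map_mem_halfspace (hφ : ∀ a, φ (gen Γ a) = g a * gen Γ a * (g a)⁻¹)
    (one_notMem : ∀ s : Letter V, 1 ∉ halfspace (g s.1) s)
    (disjoint : ∀ s t : Letter V, t.1 ∉ star Γ s.1 →
      Disjoint (halfspace (g s.1) s) (halfspace (g t.1) t)) (s : Letter V) :
    StartsWith s x ↔ φ x ∈ halfspace (g s.1) s := by
  induction x using reducedWord_induction generalizing s with
  | one =>
    rw [map_one]
    exact iff_of_false (not_startsWith_one s) (one_notMem s)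
  | letter_mul t x ht ih =>
    have starts : StartsWith t (letter Γ t * x) := startsWith_letter_mul.2 ht
    have mem : φ (letter Γ t * x) ∈ halfspace (g t.1) t := by
      rw [map_mul]
      exact map_letter_mul_mem_halfspace (hφ t.1) (mt (ih t.inv).2 ht)
    by_cases hadj : Γ.Adj s.1 t.1
    · rw [startsWith_letter_mul_of_adj hadj.symm, map_mul,
        map_letter_mul_mem_halfspace_iff hφ hadj, ih]
    by_cases hst : s = t
    · subst hst
      exact iff_of_true starts mem
    refine iff_of_false (fun h => (h.eq_or_adj starts).elim (hst ∘ Eq.symm) hadj) fun h => ?_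
    by_cases hvertex : t.1 = s.1
    · obtain rfl : s = t.inv := by
        obtain ⟨a, i⟩ := s
        obtain ⟨b, j⟩ := t
        cases i <;> cases j <;> simp_all [Letter.inv]
      exact StartsWith.not_inv mem h
    · exact Set.disjoint_left.1 (disjoint s t fun h => h.elim hvertex hadj) h mem

end PingPong

theorem eq_one_of_disjoint_halfspaces {g : V → RAAG Γ}
    (hg : ∀ a, f (gen Γ a) = g a * gen Γ a * (g a)⁻¹)
    (one_notMem : ∀ s : Letter V, 1 ∉ halfspace (g s.1) s)
    (disjoint : ∀ s t : Letter V, t.1 ∉ star Γ s.1 →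
      Disjoint (halfspace (g s.1) s) (halfspace (g t.1) t)) : f = 1 := by
  suffices fixes : ∀ a, f (gen Γ a) = gen Γ a from MulEquiv.ext fun x =>
    DFunLike.congr_fun (PresentedGroup.ext fixes : f.toMonoidHom = MonoidHom.id _) x
  intro a
  have ne_one : f⁻¹ (gen Γ a) ≠ 1 := fun h => not_startsWith_one (a, true) <| by
    rw [← (map_eq_one_iff _ (f⁻¹).injective).1 h]
    exact startsWith_letter (Γ := Γ) (a, true)
  obtain ⟨s, hs⟩ := exists_startsWith ne_one
  rw [startsWith_iff_map_mem_halfspace hg one_notMem disjoint, MulAut.apply_inv_self] at hs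
  obtain ⟨rfl, hmem⟩ := eq_and_mem_parabolic_of_mul_letter_mem_halfspace (t := (a, true))
    (one_notMem s) (by rwa [one_mul])
  have hcomm := commute_gen_of_mem_parabolic_star
    (parabolic_mono (Set.subset_insert _ _) (inv_mem hmem))
  rw [mul_one, inv_inv] at hcomm
  rw [hg, hcomm.eq, mul_inv_cancel_right]

theorem isUnionOfComponents_of_forall_adj (hC : ∀ b ∈ C, b ∉ star Γ a)
    (hadj : ∀ b ∈ C, ∀ c ∉ star Γ a, Γ.Adj b c → c ∈ C) : IsUnionOfComponents Γ a C := by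
  have closed : ∀ {y z : ((star Γ a)ᶜ : Set V)}, (Γ.induce (star Γ a)ᶜ).Reachable y z →
      y.1 ∈ C → z.1 ∈ C := by
    rintro y z ⟨q⟩
    induction q with
    | nil => exact id
    | @cons _ v _ hyv _ ih => exact fun hy => ih (hadj _ hy _ v.2 hyv)
  refine ⟨{K | ∀ x ∈ K.supp, x.1 ∈ C}, Set.Subset.antisymm (fun b hb => ?_) ?_⟩
  · exact ⟨⟨b, hC b hb⟩, Set.mem_biUnion
      (x := (Γ.induce (star Γ a)ᶜ).connectedComponentMk ⟨b, hC b hb⟩)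
      (fun x hx => closed (SimpleGraph.ConnectedComponent.exact hx).symm hb) rfl, rfl⟩
  · rintro _ ⟨x, hx, rfl⟩
    obtain ⟨K, hK, hxK⟩ := Set.mem_iUnion₂.1 hx
    exact hK x hxK

theorem partialConj_gen_of_mem (hC : IsUnionOfComponents Γ a C) (hb : b ∈ C) :
    partialConj a C hC (gen Γ b) = gen Γ a * gen Γ b * (gen Γ a)⁻¹ :=
  conjHom_gen_of_mem C _ (fun _ _ hb hbc hc => hC.commute_gen hb hbc hc) hb

theorem partialConj_gen_of_notMem (hC : IsUnionOfComponents Γ a C) (hb : b ∉ C) :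
    partialConj a C hC (gen Γ b) = gen Γ b :=
  conjHom_gen_of_notMem C _ (fun _ _ hb hbc hc => hC.commute_gen hb hbc hc) hb

theorem partialConj_inv_gen_of_mem (hC : IsUnionOfComponents Γ a C) (hb : b ∈ C) :
    (partialConj a C hC)⁻¹ (gen Γ b) = (gen Γ a)⁻¹ * gen Γ b * (gen Γ a)⁻¹⁻¹ :=
  conjHom_gen_of_mem C _ (fun _ _ hb hbc hc => (hC.commute_gen hb hbc hc).inv_left) hb

theorem partialConj_inv_gen_of_notMem (hC : IsUnionOfComponents Γ a C) (hb : b ∉ C) :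
    (partialConj a C hC)⁻¹ (gen Γ b) = gen Γ b :=
  conjHom_gen_of_notMem C _ (fun _ _ hb hbc hc => (hC.commute_gen hb hbc hc).inv_left) hb

theorem exists_mem_zpowers_partialConj (hC : IsUnionOfComponents Γ s.1 C) :
    ∃ P ∈ Subgroup.zpowers (partialConj s.1 C hC),
      (∀ b ∈ C, P (gen Γ b) = letter Γ s * gen Γ b * (letter Γ s)⁻¹) ∧
      ∀ b ∉ C, P (gen Γ b) = gen Γ b := by
  obtain ⟨a, _ | _⟩ := s
  · exact ⟨_, inv_mem (Subgroup.mem_zpowers _), fun _ => partialConj_inv_gen_of_mem hC,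
      fun _ => partialConj_inv_gen_of_notMem hC⟩
  · exact ⟨_, Subgroup.mem_zpowers _, fun _ => partialConj_gen_of_mem hC,
      fun _ => partialConj_gen_of_notMem hC⟩

theorem partialConj_mem_PAut (hC : IsUnionOfComponents Γ a C) : partialConj a C hC ∈ PAut Γ := by
  intro b
  by_cases hb : b ∈ C
  · exact isConj_iff.2 ⟨_, (partialConj_gen_of_mem hC hb).symm⟩
  · rw [partialConj_gen_of_notMem hC hb]

/-- The vertices outside the star of `a` whose image under `f` is a conjugate by an element of `K`.
For a half-space `K` bounded by a wall labelled `a`, all conjugators of such a vertex lie on the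
same side of `K`. -/
def conjugatedInto (f : MulAut (RAAG Γ)) (a : V) (K : Set (RAAG Γ)) : Set V :=
  {b | b ∉ star Γ a ∧ ∃ k ∈ K, f (gen Γ b) = k * gen Γ b * k⁻¹}

theorem mem_conjugatedInto_iff (hK : K ∈ halfspaces Γ a) (hx : f (gen Γ b) = x * gen Γ b * x⁻¹) :
    b ∈ conjugatedInto f a K ↔ b ∉ star Γ a ∧ x ∈ K := by
  refine and_congr_right fun hb => ⟨fun ⟨k, hk, hfk⟩ => ?_, fun hxK => ⟨x, hxK, hx⟩⟩
  rw [← mul_parabolic_mem_iff hK (mt mem_star_comm.1 hb)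
    (inv_mul_mem_parabolic_star (hx.symm.trans hfk)), mul_inv_cancel_left]
  exact hk

theorem isUnionOfComponents_conjugatedInto (hf : f ∈ PAut Γ) (hK : K ∈ halfspaces Γ a) :
    IsUnionOfComponents Γ a (conjugatedInto f a K) := by
  refine isUnionOfComponents_of_forall_adj (fun b hb => hb.1) fun b hb c hc hbc => ?_
  obtain ⟨-, k, -, hk⟩ := id hb
  obtain ⟨m, -, hb', hc'⟩ := exists_common_conj hbc hk (hf c) ((gen_commute hbc).map f)
  exact (mem_conjugatedInto_iff hK hc').2 ⟨hc, ((mem_conjugatedInto_iff hK hb').1 hb).2⟩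

/-- The least length of an element conjugating the generator `a` to its image under `f`. -/
noncomputable def conjLength (f : MulAut (RAAG Γ)) (a : V) : ℕ :=
  sInf {n | ∃ k : RAAG Γ, wordLength k = n ∧ f (gen Γ a) = k * gen Γ a * k⁻¹}

theorem conjLength_le (hx : f (gen Γ a) = x * gen Γ a * x⁻¹) : conjLength f a ≤ wordLength x :=
  Nat.sInf_le ⟨x, rfl, hx⟩

/-- The elements `g a` conjugate the generators to their images under `f` and have least possible
length. -/
structure IsMinimalConjugator (f : MulAut (RAAG Γ)) (g : V → RAAG Γ) : Prop where
  map_gen (a : V) : f (gen Γ a) = g a * gen Γ a * (g a)⁻¹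
  wordLength_eq (a : V) : wordLength (g a) = conjLength f a

theorem exists_isMinimalConjugator (hf : f ∈ PAut Γ) : ∃ g, IsMinimalConjugator f g := by
  have attained (a : V) := Nat.sInf_mem
    (s := {n | ∃ k : RAAG Γ, wordLength k = n ∧ f (gen Γ a) = k * gen Γ a * k⁻¹})
    (let ⟨k, hk⟩ := isConj_iff.1 (hf a); ⟨_, k, rfl, hk.symm⟩)
  choose g hlen hg using attained
  exact ⟨g, hg, hlen⟩

namespace IsMinimalConjugator

variable {g : V → RAAG Γ}

theorem not_startsWith_inv (hg : IsMinimalConjugator f g) (hs : s.1 ∈ star Γ a) :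
    ¬ StartsWith s (g a)⁻¹ := by
  intro h
  have shorter : wordLength (g a * letter Γ s) + 1 = wordLength (g a) := by
    rw [← wordLength_inv, mul_inv_rev, h.wordLength_letter_inv_mul, wordLength_inv]
  have hcomm := commute_gen_of_mem_parabolic_star (letter_mem_parabolic (Γ := Γ) hs)
  have hle : conjLength f a ≤ wordLength (g a * letter Γ s) := conjLength_le <| by
    rw [hg.map_gen, mul_assoc (g a) (letter Γ s), hcomm.eq]
    group
  have := hg.wordLength_eq a
  omega

theorem one_notMem_halfspace (hg : IsMinimalConjugator f g) (s : Letter V) :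
    1 ∉ halfspace (g s.1) s := by
  rw [mem_halfspace, mul_one]
  exact hg.not_startsWith_inv (Set.mem_insert _ _)

theorem exists_mem_halfspace (hg : IsMinimalConjugator f g) (hf : f ≠ 1) :
    ∃ (s : Letter V) (b : V), b ∉ star Γ s.1 ∧ g b ∈ halfspace (g s.1) s := by
  by_contra! outside
  have translate_outside : ∀ s t : Letter V, t.1 ∉ star Γ s.1 →
      g t.1 * letter Γ t ∉ halfspace (g s.1) s := fun s t hst => by
    rw [mul_parabolic_mem_halfspace_iff (S := {t.1}) (fun h => hst (.inl h.symm))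
      (letter_mem_parabolic rfl)]
    exact outside s t.1 hst
  refine hf (eq_one_of_disjoint_halfspaces hg.map_gen hg.one_notMem_halfspace fun s t hst => ?_)
  rcases halfspaces_nested (fun h => hst (.inr h.symm)) (halfspace_mem_halfspaces (g s.1) s)
    (halfspace_mem_halfspaces (g t.1) t) with hle | hle | hle | hle
  · exact absurd (hle (mul_letter_mem_halfspace _ _))
      (translate_outside t s (mt mem_star_comm.1 hst))
  · exact Set.disjoint_left.2 hle
  · exact absurd (hle (hg.one_notMem_halfspace s)) (hg.one_notMem_halfspace t)
  · exact absurd (mul_letter_mem_halfspace (g t.1) t) (hle (translate_outside s t hst))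

theorem wordLength_mul_letter_inv_mul_lt (hg : IsMinimalConjugator f g)
    (hb : x ∈ halfspace (g s.1) s) :
    wordLength (g s.1 * (letter Γ s)⁻¹ * (g s.1)⁻¹ * x) < wordLength x := by
  have reduced : IsReducedMul (g s.1) ((g s.1)⁻¹ * x) :=
    isReducedMul_of_forall_not_startsWith fun t ht ht' => hg.not_startsWith_inv
      ((StartsWith.eq_or_adj hb ht').imp_left fun h => congrArg Prod.fst h) ht
  rw [IsReducedMul, mul_inv_cancel_left] at reduced
  have shorter := StartsWith.wordLength_letter_inv_mul hb
  have hle := wordLength_mul_le (g s.1) ((letter Γ s)⁻¹ * ((g s.1)⁻¹ * x))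
  simp only [← mul_assoc] at reduced shorter hle
  omega

end IsMinimalConjugator

theorem exists_conjLength_mul_lt (hf : f ∈ PAut Γ) (hne : f ≠ 1) :
    ∃ a, ∃ K, ∃ hK : K ∈ halfspaces Γ a, ∃ P ∈ Subgroup.zpowers
        (partialConj a (conjugatedInto f a K) (isUnionOfComponents_conjugatedInto hf hK)),
      (∀ b, conjLength (f * P) b ≤ conjLength f b) ∧
        ∃ b, conjLength (f * P) b < conjLength f b := by
  obtain ⟨g, hg⟩ := exists_isMinimalConjugator hf
  obtain ⟨s, b, hbs, hb⟩ := hg.exists_mem_halfspace hne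
  have hK := halfspace_mem_halfspaces (g s.1) s
  obtain ⟨P, hP, P_mem, P_notMem⟩ := exists_mem_zpowers_partialConj (s := s.inv)
    (isUnionOfComponents_conjugatedInto hf hK)
  have decreases : ∀ c ∈ conjugatedInto f s.1 (halfspace (g s.1) s),
      conjLength (f * P) c < conjLength f c := by
    intro c hc
    rw [← hg.wordLength_eq]
    refine (conjLength_le ?_).trans_lt (hg.wordLength_mul_letter_inv_mul_lt
      ((mem_conjugatedInto_iff hK (hg.map_gen c)).1 hc).2)
    simp only [MulAut.mul_apply, P_mem c hc, letter_inv, map_mul, map_inv,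
      map_letter_eq_conj (hg.map_gen _), hg.map_gen c]
    group
  refine ⟨s.1, _, hK, P, hP, fun c => ?_, b,
    decreases b ((mem_conjugatedInto_iff hK (hg.map_gen b)).2 ⟨hbs, hb⟩)⟩
  by_cases hc : c ∈ conjugatedInto f s.1 (halfspace (g s.1) s)
  · exact (decreases c hc).le
  · rw [conjLength, conjLength, MulAut.mul_apply, P_notMem c hc]

end Conjugating

/-! ### Exponent sums -/

section ExponentSum

variable {V : Type u} {Γ : SimpleGraph V} {a b : V} {S : Set V} {f : MulAut (RAAG Γ)}

open Classical in
/-- The abelianization of `A_Γ`: the homomorphism sending the generators to the standard basis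
vectors of `ℤ^V`. -/
noncomputable def exponentSumHom (Γ : SimpleGraph V) : RAAG Γ →* Multiplicative (V → ℤ) :=
  lift (fun a => .ofAdd (Pi.single a 1)) fun _ _ _ => .all _ _

/-- The exponent sums of the generators in an element of `A_Γ`. -/
noncomputable def exponentSum (g : RAAG Γ) : V → ℤ := (exponentSumHom Γ g).toAdd

theorem exponentSum_gen [DecidableEq V] (a : V) : exponentSum (gen Γ a) = Pi.single a 1 := by
  rw [exponentSum, exponentSumHom, lift_gen, toAdd_ofAdd]
  congr!

@[simp]
theorem exponentSum_one : exponentSum (1 : RAAG Γ) = 0 :=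
  congrArg Multiplicative.toAdd (map_one _)

@[simp]
theorem exponentSum_mul (g h : RAAG Γ) :
    exponentSum (g * h) = exponentSum g + exponentSum h :=
  congrArg Multiplicative.toAdd (map_mul _ _ _)

@[simp]
theorem exponentSum_inv (g : RAAG Γ) : exponentSum g⁻¹ = -exponentSum g :=
  congrArg Multiplicative.toAdd (map_inv _ _)

@[simp]
theorem exponentSum_zpow (g : RAAG Γ) (n : ℤ) : exponentSum (g ^ n) = n • exponentSum g :=
  congrArg Multiplicative.toAdd (map_zpow _ _ _)

theorem exponentSum_conj (g h : RAAG Γ) : exponentSum (g * h * g⁻¹) = exponentSum h := by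
  rw [exponentSum_mul, exponentSum_mul, exponentSum_inv, add_neg_cancel_comm]

theorem exponentSum_apply_eq_zero (ha : a ∉ S) {g : RAAG Γ} (hg : g ∈ parabolic Γ S) :
    exponentSum g a = 0 := by
  classical
  induction hg using Subgroup.closure_induction with
  | mem _ h =>
    obtain ⟨b, hb, rfl⟩ := h
    rw [exponentSum_gen, Pi.single_eq_of_ne (ne_of_mem_of_not_mem hb ha).symm]
  | one => rw [exponentSum_one, Pi.zero_apply]
  | mul g h _ _ hg hh => rw [exponentSum_mul, Pi.add_apply, hg, hh, add_zero]
  | inv g _ hg => rw [exponentSum_inv, Pi.neg_apply, hg, neg_zero]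

theorem exponentSum_map_of_forall_gen {W : Type v} {Λ : SimpleGraph W} {φ ψ : RAAG Λ →* RAAG Γ}
    (h : ∀ w, exponentSum (φ (gen Λ w)) = exponentSum (ψ (gen Λ w))) (x : RAAG Λ) :
    exponentSum (φ x) = exponentSum (ψ x) :=
  have eq_on_gen : (exponentSumHom Γ).comp φ = (exponentSumHom Γ).comp ψ := PresentedGroup.ext h
  DFunLike.congr_fun eq_on_gen x

theorem exponentSum_apply_of_mem_PAut (hf : f ∈ PAut Γ) (g : RAAG Γ) :
    exponentSum (f g) = exponentSum g :=
  exponentSum_map_of_forall_gen (φ := f.toMonoidHom) (ψ := .id _) (fun a => by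
    obtain ⟨k, hk⟩ := isConj_iff.1 (hf a)
    exact (congrArg exponentSum hk.symm).trans (exponentSum_conj k _)) g

theorem toAdd_eq_exponentSum_apply [DecidableEq V] {ψ : RAAG Γ →* Multiplicative ℤ}
    (hψ : ∀ b, ψ (gen Γ b) = .ofAdd (if a = b then 1 else 0)) (g : RAAG Γ) :
    (ψ g).toAdd = exponentSum g a := by
  have eq_on_gen : ψ =
      (AddMonoidHom.toMultiplicative (Pi.evalAddMonoidHom _ a)).comp (exponentSumHom Γ) :=
    PresentedGroup.ext fun b => (hψ b).trans <| congrArg Multiplicative.ofAdd <| by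
      change _ = exponentSum (gen Γ b) a
      rw [exponentSum_gen, Pi.single_apply]
  exact congrArg Multiplicative.toAdd (DFunLike.congr_fun eq_on_gen g)

theorem map_eq_prod_zpow_exponentSum [Fintype V] {A : Type*} [CommGroup A] (ψ : RAAG Γ →* A)
    (g : RAAG Γ) : ψ g = ∏ a, ψ (gen Γ a) ^ exponentSum g a := by
  classical
  have eq_on_gen : ψ = MonoidHom.mk' (fun g => ∏ a, ψ (gen Γ a) ^ exponentSum g a) (fun g h => by
      simp only [exponentSum_mul, Pi.add_apply, zpow_add, Finset.prod_mul_distrib]) :=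
    PresentedGroup.ext fun a => by
      change ψ (gen Γ a) = ∏ b, ψ (gen Γ b) ^ exponentSum (gen Γ a) b
      rw [Finset.prod_eq_single_of_mem a (Finset.mem_univ a) fun b _ hb => by
        rw [exponentSum_gen, Pi.single_eq_of_ne hb, zpow_zero], exponentSum_gen,
        Pi.single_eq_same, zpow_one]
  exact DFunLike.congr_fun eq_on_gen g

/-- The integral Heisenberg group; `⟨x, y, z⟩` is the upper unitriangular matrix with entries `x`
and `y` above the diagonal and `z` in the corner. -/
@[ext]
structure Heisenberg where
  /-- The entry in position `(1, 2)`. -/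
  x : ℤ
  /-- The entry in position `(2, 3)`. -/
  y : ℤ
  /-- The entry in position `(1, 3)`. -/
  z : ℤ

namespace Heisenberg

instance : Mul Heisenberg := ⟨fun g h => ⟨g.x + h.x, g.y + h.y, g.z + h.z + g.x * h.y⟩⟩

instance : One Heisenberg := ⟨⟨0, 0, 0⟩⟩

instance : Inv Heisenberg := ⟨fun g => ⟨-g.x, -g.y, -g.z + g.x * g.y⟩⟩

@[simp] theorem mul_x (g h : Heisenberg) : (g * h).x = g.x + h.x := rfl
@[simp] theorem mul_y (g h : Heisenberg) : (g * h).y = g.y + h.y := rfl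
@[simp] theorem mul_z (g h : Heisenberg) : (g * h).z = g.z + h.z + g.x * h.y := rfl
@[simp] theorem one_x : (1 : Heisenberg).x = 0 := rfl
@[simp] theorem one_y : (1 : Heisenberg).y = 0 := rfl
@[simp] theorem one_z : (1 : Heisenberg).z = 0 := rfl
@[simp] theorem inv_x (g : Heisenberg) : g⁻¹.x = -g.x := rfl
@[simp] theorem inv_y (g : Heisenberg) : g⁻¹.y = -g.y := rfl
@[simp] theorem inv_z (g : Heisenberg) : g⁻¹.z = -g.z + g.x * g.y := rfl

instance : Group Heisenberg := Group.ofLeftAxioms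
  (fun _ _ _ => by ext <;> simp <;> ring) (fun _ => by ext <;> simp) (fun _ => by ext <;> simp)

theorem commute_iff {g h : Heisenberg} : Commute g h ↔ g.x * h.y = h.x * g.y := by
  simp only [commute_iff_eq, Heisenberg.ext_iff, mul_x, mul_y, mul_z, add_comm h.x, add_comm h.y,
    add_comm h.z, true_and, add_right_inj]

/-- The first superdiagonal entry, as a homomorphism. -/
def xHom : Heisenberg →* Multiplicative ℤ := MonoidHom.mk' (fun g => .ofAdd g.x) fun _ _ => rfl

/-- The second superdiagonal entry, as a homomorphism. -/
def yHom : Heisenberg →* Multiplicative ℤ := MonoidHom.mk' (fun g => .ofAdd g.y) fun _ _ => rfl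

end Heisenberg

/-- Since `a` and `b` are not adjacent, `A_Γ` maps to the Heisenberg group in such a way that the
superdiagonal entries record the exponent sums of `a` and `b`. -/
theorem exponentSum_mul_exponentSum_of_commute (hab : ¬ Γ.Adj a b) {g h : RAAG Γ}
    (hgh : Commute g h) :
    exponentSum g a * exponentSum h b = exponentSum h a * exponentSum g b := by
  classical
  have not_both {c d : V} (hcd : Γ.Adj c d) : ¬ (a = c ∧ b = d) :=
    fun ⟨hc, hd⟩ => hab (hc ▸ hd ▸ hcd)
  let θ : RAAG Γ →* Heisenberg :=
    lift (fun c => ⟨if a = c then 1 else 0, if b = c then 1 else 0, 0⟩) fun c d hcd => by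
      simp only [Heisenberg.commute_iff, ite_zero_mul_ite_zero, not_both hcd,
        not_both hcd.symm, if_false]
  have hx := toAdd_eq_exponentSum_apply (a := a) (ψ := Heisenberg.xHom.comp θ)
    fun c => congrArg Heisenberg.xHom (lift_gen _ _ c)
  have hy := toAdd_eq_exponentSum_apply (a := b) (ψ := Heisenberg.yHom.comp θ)
    fun c => congrArg Heisenberg.yHom (lift_gen _ _ c)
  rw [← hx, ← hx, ← hy, ← hy]
  exact Heisenberg.commute_iff.1 (hgh.map θ)

end ExponentSum

/-! ### Lifts and homology -/

section Homology

variable {W : Type u} {V : Type v} {Λ : SimpleGraph W} {Γ : SimpleGraph V} {p : Λ →g Γ}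
  {f : MulAut (RAAG Γ)} {F : MulAut (RAAG Λ)}

theorem map_gen (w : W) : map p (gen Λ w) = gen Γ (p w) := lift_gen _ _ _

theorem isLift_of_forall_gen (h : ∀ w, f (gen Γ (p w)) = map p (F (gen Λ w))) : IsLift p F f :=
  have eq_on_gen : f.toMonoidHom.comp (map p) = (map p).comp F.toMonoidHom :=
    PresentedGroup.ext fun w => (congrArg f (map_gen w)).trans (h w)
  DFunLike.congr_fun eq_on_gen

open Classical in
theorem exponentSum_map [Fintype W] (x : RAAG Λ) (c : V) :
    exponentSum (map p x) c = ∑ b with p b = c, exponentSum x b := by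
  have h := congrArg Multiplicative.toAdd <| map_eq_prod_zpow_exponentSum
    ((AddMonoidHom.toMultiplicative (Pi.evalAddMonoidHom _ c)).comp
      ((exponentSumHom Γ).comp (map p))) x
  change exponentSum (map p x) c =
    (∏ b, Multiplicative.ofAdd (exponentSum (map p (gen Λ b)) c) ^ exponentSum x b).toAdd at h
  simp only [h, map_gen, exponentSum_gen, Pi.single_apply, toAdd_prod, toAdd_zpow, toAdd_ofAdd,
    smul_eq_mul, mul_ite, mul_one, mul_zero, Finset.sum_filter, eq_comm]

open Classical in
/-- Integral vectors `X` and `Y` on `Λ` that look like the exponent sums of two commuting elements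
of `A_Λ` whose images in `A_Γ` have the exponent sums of the generators `c` and `d`. -/
structure IsHomologyLift [Fintype W] (p : Λ →g Γ) (c d : V) (X Y : W → ℤ) : Prop where
  mul_eq_mul (a b : W) (hab : ¬ Λ.Adj a b) : X a * Y b = Y a * X b
  sum_left (e : V) : ∑ b with p b = e, X b = (Pi.single c 1 : V → ℤ) e
  sum_right (e : V) : ∑ b with p b = e, Y b = (Pi.single d 1 : V → ℤ) e

namespace IsHomologyLift

variable [Fintype W] {c d : V} {X Y : W → ℤ} {a b : W}

theorem symm (h : IsHomologyLift p c d X Y) : IsHomologyLift p d c Y X :=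
  ⟨fun a b hab => (h.mul_eq_mul a b hab).symm, h.sum_right, h.sum_left⟩

theorem exists_mul_ne_mul (h : IsHomologyLift p c d X Y) (hcd : c ≠ d) (ha : X a ≠ 0) :
    ∃ e, X a * Y e ≠ Y a * X e := by
  classical
  by_contra! parallel
  have sums : X a * ∑ b with p b = d, Y b = Y a * ∑ b with p b = d, X b := by
    simp only [Finset.mul_sum, parallel]
  rw [h.sum_left, h.sum_right, Pi.single_eq_same, Pi.single_eq_of_ne hcd.symm, mul_one,
    mul_zero] at sums
  exact ha sums

/-- The vectors `(X a, Y a)` and `(X b, Y b)` are parallel, so a vertex `e` witnessing that the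
first one is nonzero would be adjacent to both `a` and `b`. -/
theorem eq_zero_of_fiber (h : IsHomologyLift p c d X Y) (hp : ∀ w, Set.InjOn p (Λ.neighborSet w))
    (hcd : c ≠ d) (hab : a ≠ b) (hpab : p a = p b) (ha : X a ≠ 0) : X b = 0 := by
  obtain ⟨e, he⟩ := h.exists_mul_ne_mul hcd ha
  have hea : Λ.Adj e a := by
    by_contra hn
    exact he (h.mul_eq_mul a e fun hae => hn hae.symm)
  have heb : ¬ Λ.Adj b e := fun hbe => hab (hp e hea hbe.symm hpab)
  have hadj : ¬ Λ.Adj a b := fun hadj => (p.map_adj hadj).ne hpab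
  have hzero : X b * (X a * Y e - Y a * X e) = 0 := by
    linear_combination X a * h.mul_eq_mul b e heb + X e * h.mul_eq_mul a b hadj
  exact (mul_eq_zero.1 hzero).resolve_right (sub_ne_zero.2 he)

open Classical in
theorem eq_single (h : IsHomologyLift p c d X Y) (hp : ∀ w, Set.InjOn p (Λ.neighborSet w))
    (hcd : c ≠ d) : ∃ a, p a = c ∧ X = Pi.single a 1 := by
  have eq_sum {a : W} (ha : X a ≠ 0) : X a = (Pi.single c 1 : V → ℤ) (p a) := by
    rw [← h.sum_left, Finset.sum_eq_single_of_mem a (by simp)]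
    exact fun b hb hba =>
      h.eq_zero_of_fiber hp hcd hba.symm (Finset.mem_filter.1 hb).2.symm ha
  have fiber_of_ne_zero {a : W} (ha : X a ≠ 0) : p a = c := by
    by_contra hne
    exact ha ((eq_sum ha).trans (Pi.single_eq_of_ne hne _))
  obtain ⟨a, -, ha⟩ : ∃ a ∈ Finset.univ.filter (p · = c), X a ≠ 0 :=
    Finset.exists_ne_zero_of_sum_ne_zero (by rw [h.sum_left, Pi.single_eq_same]; exact one_ne_zero)
  refine ⟨a, fiber_of_ne_zero ha, funext fun e => ?_⟩
  rcases eq_or_ne e a with rfl | hea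
  · rw [eq_sum ha, fiber_of_ne_zero ha, Pi.single_eq_same, Pi.single_eq_same]
  · rw [Pi.single_eq_of_ne hea]
    by_contra he
    exact he (h.eq_zero_of_fiber hp hcd hea.symm
      ((fiber_of_ne_zero ha).trans (fiber_of_ne_zero he).symm) ha)

open Classical in
theorem exists_adj (h : IsHomologyLift p c d X Y) (hp : ∀ w, Set.InjOn p (Λ.neighborSet w))
    (hcd : c ≠ d) :
    ∃ a b, p a = c ∧ Λ.Adj a b ∧ X = Pi.single a 1 ∧ Y = Pi.single b 1 := by
  obtain ⟨a, hac, rfl⟩ := h.eq_single hp hcd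
  obtain ⟨b, hbd, rfl⟩ := h.symm.eq_single hp hcd.symm
  refine ⟨a, b, hac, ?_, rfl, rfl⟩
  by_contra hab
  have hne : a ≠ b := fun e => hcd (by rw [← hac, ← hbd, e])
  have := h.mul_eq_mul a b hab
  rw [Pi.single_eq_same, Pi.single_eq_same, Pi.single_eq_of_ne hne, zero_mul] at this
  exact one_ne_zero this

end IsHomologyLift

theorem IsCovering.not_isIsolated (hp : IsCovering p) (hΓ : ∀ a, ¬ Γ.IsIsolated a) (w : W) :
    ¬ Λ.IsIsolated w := by
  obtain ⟨c, hc⟩ := SimpleGraph.exists_adj_iff_not_isIsolated.2 (hΓ (p w))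
  obtain ⟨u, hu, -⟩ := (hp.bijOn w).surjOn hc
  exact SimpleGraph.Adj.not_isIsolated_left hu

theorem IsLift.isHomologyLift [Fintype W] (hF : IsLift p F f) (hf : f ∈ PAut Γ) {w u : W}
    (hwu : Λ.Adj w u) :
    IsHomologyLift p (p w) (p u) (exponentSum (F (gen Λ w))) (exponentSum (F (gen Λ u))) := by
  classical
  have sum_fiber (w : W) (e : V) : ∑ b with p b = e, exponentSum (F (gen Λ w)) b =
      (Pi.single (p w) 1 : V → ℤ) e := by
    rw [← exponentSum_map, ← hF, exponentSum_apply_of_mem_PAut hf, map_gen, exponentSum_gen]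
  refine ⟨fun a b hab => ?_, fun e => ?_, fun e => ?_⟩
  · rw [exponentSum_mul_exponentSum_of_commute hab ((gen_commute hwu).map F), mul_comm]
  · convert sum_fiber w e
  · convert sum_fiber u e

theorem exponentSum_gen_injective : Function.Injective fun a => exponentSum (gen Γ a) := by
  classical
  intro a b hab
  simp only [exponentSum_gen] at hab
  by_contra hne
  have := congrFun hab a
  rw [Pi.single_eq_same, Pi.single_eq_of_ne hne] at this
  exact one_ne_zero this

theorem exponentSum_eq_of_apply_eq [Finite W] {x y : RAAG Λ}
    (h : exponentSum (F x) = exponentSum (F y)) : exponentSum x = exponentSum y := by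
  cases nonempty_fintype W
  have ψ_eq := map_eq_prod_zpow_exponentSum ((exponentSumHom Λ).comp F.symm.toMonoidHom)
  have hsymm : exponentSumHom Λ (F.symm (F x)) = exponentSumHom Λ (F.symm (F y)) :=
    (ψ_eq (F x)).trans (h ▸ (ψ_eq (F y)).symm)
  rw [F.symm_apply_apply, F.symm_apply_apply] at hsymm
  exact congrArg Multiplicative.toAdd hsymm

theorem IsLift.exists_hom [Finite W] (hF : IsLift p F f) (hf : f ∈ PAut Γ)
    (hp : ∀ w, Set.InjOn p (Λ.neighborSet w)) (hΛ : ∀ w, ¬ Λ.IsIsolated w) :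
    ∃ σ : Λ →g Λ, (∀ w, p (σ w) = p w) ∧
      ∀ w, exponentSum (F (gen Λ w)) = exponentSum (gen Λ (σ w)) := by
  classical
  cases nonempty_fintype W
  have adj_images {w u : W} (hwu : Λ.Adj w u) : ∃ a b, p a = p w ∧ Λ.Adj a b ∧
      exponentSum (F (gen Λ w)) = exponentSum (gen Λ a) ∧
      exponentSum (F (gen Λ u)) = exponentSum (gen Λ b) := by
    simp only [exponentSum_gen]
    convert (hF.isHomologyLift hf hwu).exists_adj hp (p.map_adj hwu).ne
  have image (w : W) : ∃ a, p a = p w ∧ exponentSum (F (gen Λ w)) = exponentSum (gen Λ a) := by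
    obtain ⟨u, hwu⟩ := SimpleGraph.exists_adj_iff_not_isIsolated.2 (hΛ w)
    obtain ⟨a, -, hpa, -, ha, -⟩ := adj_images hwu
    exact ⟨a, hpa, ha⟩
  choose σ hpσ hσ using image
  refine ⟨⟨σ, fun {w u} hwu => ?_⟩, hpσ, hσ⟩
  obtain ⟨a, b, -, hab, ha, hb⟩ := adj_images hwu
  rwa [exponentSum_gen_injective ((hσ w).symm.trans ha),
    exponentSum_gen_injective ((hσ u).symm.trans hb)]

theorem exists_iso_of_injective [Finite W] (σ : Λ →g Λ) (hσ : Function.Injective σ) :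
    ∃ τ : Λ ≃g Λ, ∀ w, τ w = σ w := by
  refine ⟨⟨.ofBijective σ (Finite.injective_iff_bijective.1 hσ), fun {w u} => ⟨fun h => ?_,
    σ.map_adj⟩⟩, fun _ => rfl⟩
  obtain ⟨⟨e, he⟩, hmap⟩ := Finite.surjective_of_injective
    (SimpleGraph.Hom.mapEdgeSet.injective σ hσ) ⟨s(σ w, σ u), h⟩
  have : e = s(w, u) := Sym2.map.injective hσ (congrArg Subtype.val hmap)
  rwa [this] at he

/-- The isomorphism of right-angled Artin groups induced by a graph isomorphism. -/
def mapIso (σ : Λ ≃g Γ) : RAAG Λ ≃* RAAG Γ :=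
  MonoidHom.toMulEquiv (map σ.toHom) (map σ.symm.toHom)
    (PresentedGroup.ext fun w => by
      change map σ.symm.toHom (map σ.toHom (gen Λ w)) = gen Λ w
      rw [map_gen, map_gen]
      exact congrArg (gen Λ) (σ.symm_apply_apply w))
    (PresentedGroup.ext fun a => by
      change map σ.toHom (map σ.symm.toHom (gen Γ a)) = gen Γ a
      rw [map_gen, map_gen]
      exact congrArg (gen Γ) (σ.apply_symm_apply a))

theorem mapIso_gen (σ : Λ ≃g Γ) (w : W) : mapIso σ (gen Λ w) = gen Γ (σ w) := map_gen w

theorem IsDeck.symm {σ : Λ ≃g Λ} (hσ : IsDeck p σ) : IsDeck p σ.symm := fun w => by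
  rw [← hσ, RelIso.apply_symm_apply]

theorem IsDeck.isLift_mapIso {σ : Λ ≃g Λ} (hσ : IsDeck p σ) : IsLift p (mapIso σ) 1 :=
  isLift_of_forall_gen fun w => by rw [mapIso_gen, map_gen, hσ, MulAut.one_apply]

theorem exists_isLift_exponentSum_apply_eq [Finite W] (hf : f ∈ LPAut p)
    (hp : ∀ w, Set.InjOn p (Λ.neighborSet w)) (hΛ : ∀ w, ¬ Λ.IsIsolated w) :
    ∃ F : MulAut (RAAG Λ), IsLift p F f ∧ ∀ x, exponentSum (F x) = exponentSum x := by
  obtain ⟨⟨F, hF⟩, hf⟩ := hf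
  obtain ⟨σ, hpσ, hσ⟩ := hF.exists_hom hf hp hΛ
  have σ_injective : Function.Injective σ := fun w u hwu =>
    exponentSum_gen_injective (exponentSum_eq_of_apply_eq (by rw [hσ, hσ, hwu]))
  obtain ⟨τ, hτ⟩ := exists_iso_of_injective σ σ_injective
  have τ_deck : IsDeck p τ := fun w => by rw [hτ, hpσ]
  refine ⟨F * mapIso τ.symm, fun x => ?_, exponentSum_map_of_forall_gen
    (φ := (F * mapIso τ.symm).toMonoidHom) (ψ := .id _) fun w => ?_⟩
  · exact (congrArg f (τ_deck.symm.isLift_mapIso x)).trans (hF _)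
  · change exponentSum (F (mapIso τ.symm (gen Λ w))) = exponentSum (gen Λ w)
    rw [mapIso_gen, hσ, ← hτ, RelIso.apply_symm_apply]

end Homology

/-! ### Conjugators of a lift -/

section Conjugators

open Set Subgroup

variable {W : Type u} {V : Type v} {Λ : SimpleGraph W} {Γ : SimpleGraph V}

theorem inv_mul_mem_parabolic_of_conj_mem {a c : V} {x k l : RAAG Γ} (hc : ¬ Γ.Adj a c)
    (hx : exponentSum x c ≠ 0) (hk : k⁻¹ * x * k ∈ parabolic Γ {a}ᶜ)
    (hl : l⁻¹ * x * l ∈ parabolic Γ {a}ᶜ) : k⁻¹ * l ∈ parabolic Γ {a}ᶜ := by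
  by_contra hkl
  have hl' : (k⁻¹ * l)⁻¹ * (k⁻¹ * x * k) * (k⁻¹ * l) ∈ parabolic Γ {a}ᶜ := by
    simpa only [mul_inv_rev, inv_inv, mul_assoc, mul_inv_cancel_left] using hl
  obtain ⟨n, g, hn, hg⟩ := exists_zpow_conj_mem_parabolic hk hl' hkl
  have hsum : n * exponentSum x c = 0 := by
    simpa using exponentSum_apply_eq_zero (a := c) hc hg
  exact mul_ne_zero hn hx hsum

theorem inv_mul_mem_parabolic_of_commute {a c d : V} {x y k l : RAAG Γ} (hxy : Commute x y)
    (hc : ¬ Γ.Adj a c) (hx : exponentSum x c ≠ 0) (hd : ¬ Γ.Adj a d) (hy : exponentSum y d ≠ 0)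
    (hk : k⁻¹ * x * k ∈ parabolic Γ {a}ᶜ) (hl : l⁻¹ * y * l ∈ parabolic Γ {a}ᶜ) :
    k⁻¹ * l ∈ parabolic Γ {a}ᶜ := by
  have hyk : (y * k)⁻¹ * x * (y * k) ∈ parabolic Γ {a}ᶜ := by
    rwa [show (y * k)⁻¹ * x * (y * k) = k⁻¹ * (y⁻¹ * (x * y)) * k by group, hxy.eq,
      inv_mul_cancel_left]
  have hky : k⁻¹ * y * k ∈ parabolic Γ {a}ᶜ := by
    simpa only [mul_assoc] using inv_mul_mem_parabolic_of_conj_mem hc hx hk hyk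
  exact inv_mul_mem_parabolic_of_conj_mem hd hy hky hl

/-- Otherwise `x` skewers a half-space at `a`, so a suitable product of powers of `x` and of the
conjugate of `y` lies in a conjugate of the parabolic subgroup of the link of `a`; its exponent sum
at `c` is both zero and a nonzero multiple of that of `y`. -/
theorem IsCyclicallyReduced.mem_parabolic_of_commute {a c : V} {x y k : RAAG Γ}
    (hx : IsCyclicallyReduced x) (hxy : Commute (k * x * k⁻¹) y) (hc : ¬ Γ.Adj a c)
    (hxc : exponentSum x c = 0) (hyc : exponentSum y c ≠ 0) : x ∈ parabolic Γ {a}ᶜ := by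
  by_contra hxa
  obtain ⟨K, hK, hxK⟩ := hx.exists_smul_ssubset hxa
  have hxy' : Commute x (k⁻¹ * y * k) := by
    simpa [mul_assoc] using (Commute.conj_iff k⁻¹).2 hxy
  obtain ⟨m, n, g, hn, hg⟩ := exists_zpow_mul_zpow_conj_mem_parabolic hK hxK hxy'
  have hsum : n * exponentSum y c = 0 := by
    simpa [hxc] using exponentSum_apply_eq_zero (a := c) hc hg
  exact mul_ne_zero hn hyc hsum

/-- The vertices `w` and `y` are joined by a walk all of whose vertices lie in `S`. -/
def ReachableIn (Λ : SimpleGraph W) (S : Set W) (w y : W) : Prop :=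
  ∃ q : Λ.Walk w y, ∀ z ∈ q.support, z ∈ S

namespace ReachableIn

variable {S : Set W} {w y z : W}

theorem left_mem : ReachableIn Λ S w y → w ∈ S := fun ⟨q, hq⟩ => hq w q.start_mem_support

theorem symm : ReachableIn Λ S w y → ReachableIn Λ S y w := fun ⟨q, hq⟩ =>
  ⟨q.reverse, fun z hz => hq z (by rwa [SimpleGraph.Walk.support_reverse, List.mem_reverse] at hz)⟩

theorem trans : ReachableIn Λ S w y → ReachableIn Λ S y z → ReachableIn Λ S w z :=
  fun ⟨q, hq⟩ ⟨r, hr⟩ => ⟨q.append r, fun x hx =>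
    ((SimpleGraph.Walk.mem_support_append_iff q r).1 hx).elim (hq x) (hr x)⟩

theorem of_adj (hw : w ∈ S) (hy : y ∈ S) (hwy : Λ.Adj w y) : ReachableIn Λ S w y :=
  ⟨hwy.toWalk, by simpa using ⟨hw, hy⟩⟩

theorem map {T : Set V} (φ : Λ →g Γ) (hφ : MapsTo φ S T) :
    ReachableIn Λ S w y → ReachableIn Γ T (φ w) (φ y) := fun ⟨q, hq⟩ =>
  ⟨q.map φ, by simpa using fun z hz => hφ (hq z hz)⟩

theorem mono {T : Set W} (hST : S ⊆ T) : ReachableIn Λ S w y → ReachableIn Λ T w y :=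
  fun ⟨q, hq⟩ => ⟨q, fun z hz => hST (hq z hz)⟩

theorem reachable : ReachableIn Λ S w y → Λ.Reachable w y := fun ⟨q, _⟩ => q.reachable

end ReachableIn

section Family

variable {φ : RAAG Λ →* RAAG Λ} {k x : W → RAAG Λ}

theorem mem_parabolic_and_inv_mul_mem_of_adj (hφ : ∀ g, exponentSum (φ g) = exponentSum g)
    (hx : ∀ w, IsCyclicallyReduced (x w)) (hkx : ∀ w, φ (gen Λ w) = k w * x w * (k w)⁻¹)
    {a w u : W} (hwu : Λ.Adj w u) (hw : w ∉ star Λ a) (hu : u ∉ star Λ a) :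
    x w ∈ parabolic Λ {a}ᶜ ∧ (k w)⁻¹ * k u ∈ parabolic Λ {a}ᶜ := by
  classical
  have sum_self (w) : exponentSum (φ (gen Λ w)) w ≠ 0 := by simp [hφ, exponentSum_gen]
  have x_mem {w u : W} (hwu : Λ.Adj w u) (hu : u ∉ star Λ a) : x w ∈ parabolic Λ {a}ᶜ := by
    refine (hx w).mem_parabolic_of_commute (k := k w) (y := φ (gen Λ u)) (c := u) ?_
      (fun h => hu (Or.inr h)) ?_ (sum_self u)
    · exact hkx w ▸ (gen_commute hwu).map φ
    · rw [← exponentSum_conj (k w), ← hkx, hφ, exponentSum_gen, Pi.single_eq_of_ne hwu.ne']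
  have conj_mem {w : W} (hw : x w ∈ parabolic Λ {a}ᶜ) :
      (k w)⁻¹ * φ (gen Λ w) * k w ∈ parabolic Λ {a}ᶜ := by
    rwa [hkx, mul_assoc, inv_mul_cancel_right, inv_mul_cancel_left]
  exact ⟨x_mem hwu hu, inv_mul_mem_parabolic_of_commute ((gen_commute hwu).map φ)
    (fun h => hw (Or.inr h)) (sum_self w) (fun h => hu (Or.inr h)) (sum_self u)
    (conj_mem (x_mem hwu hu)) (conj_mem (x_mem hwu.symm hw))⟩

theorem mem_parabolic_and_inv_mul_mem_of_reachableIn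
    (hφ : ∀ g, exponentSum (φ g) = exponentSum g) (hx : ∀ w, IsCyclicallyReduced (x w))
    (hkx : ∀ w, φ (gen Λ w) = k w * x w * (k w)⁻¹) {a w u : W} (hne : w ≠ u)
    (hwu : ReachableIn Λ (star Λ a)ᶜ w u) :
    x w ∈ parabolic Λ {a}ᶜ ∧ (k w)⁻¹ * k u ∈ parabolic Λ {a}ᶜ := by
  obtain ⟨q, hq⟩ := hwu
  induction q with
  | nil => exact absurd rfl hne
  | @cons w v u hwv q ih =>
    simp only [SimpleGraph.Walk.support_cons, List.forall_mem_cons] at hq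
    have step := mem_parabolic_and_inv_mul_mem_of_adj hφ hx hkx hwv hq.1
      (hq.2 v q.start_mem_support)
    refine ⟨step.1, ?_⟩
    rcases eq_or_ne v u with rfl | hvu
    · exact step.2
    · simpa only [mul_assoc, mul_inv_cancel_left] using mul_mem step.2 (ih hvu hq.2).2

end Family

variable {p : Λ →g Γ} {f : MulAut (RAAG Γ)} {F : MulAut (RAAG Λ)} {v : V} {w u : W}

theorem map_mem_parabolic_compl_singleton {g : RAAG Λ}
    (hg : ∀ a, p a = v → g ∈ parabolic Λ {a}ᶜ) : map p g ∈ parabolic Γ {v}ᶜ := by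
  have hle : parabolic Λ (⋂ a : {a // p a = v}, {a.1}ᶜ) ≤ (parabolic Γ {v}ᶜ).comap (map p) := by
    rw [parabolic, closure_le]
    rintro _ ⟨w, hw, rfl⟩
    rw [SetLike.mem_coe, mem_comap, map_gen]
    exact gen_mem_parabolic fun hpw => mem_iInter.1 hw ⟨w, hpw⟩ rfl
  exact hle (by simpa [parabolic_iInter, mem_iInf] using hg)

theorem IsLift.inv_mul_map_mem_parabolic (hF : IsLift p F f) (hf : f ∈ PAut Γ)
    (hw : p w ∉ star Γ v) {k x : RAAG Λ} (hx : ∀ a, p a = v → x ∈ parabolic Λ {a}ᶜ)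
    (hkx : F (gen Λ w) = k * x * k⁻¹) {g : RAAG Γ}
    (hg : f (gen Γ (p w)) = g * gen Γ (p w) * g⁻¹) : g⁻¹ * map p k ∈ parabolic Γ {v}ᶜ := by
  classical
  refine inv_mul_mem_parabolic_of_conj_mem (x := f (gen Γ (p w))) (c := p w)
    (fun h => hw (Or.inr h)) ?_ ?_ ?_
  · simp [exponentSum_apply_of_mem_PAut hf, exponentSum_gen]
  · rw [hg, mul_assoc, inv_mul_cancel_right, inv_mul_cancel_left]
    exact gen_mem_parabolic fun h => hw (Or.inl h)
  · rw [← map_gen, hF, hkx, map_mul, map_mul, map_inv, mul_assoc, inv_mul_cancel_right,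
      inv_mul_cancel_left]
    exact map_mem_parabolic_compl_singleton hx

theorem inv_mul_mem_parabolic_of_forall_reachableIn [Finite W]
    (hp : ∀ w, Set.InjOn p (Λ.neighborSet w)) (hΛ : ∀ w, ¬ Λ.IsIsolated w) (hf : f ∈ LPAut p)
    (hw : p w ∉ star Γ v) (hu : p u ∉ star Γ v) (hwu : ∀ a, p a = v → ReachableIn Λ (star Λ a)ᶜ w u)
    {g h : RAAG Γ} (hg : f (gen Γ (p w)) = g * gen Γ (p w) * g⁻¹)
    (hh : f (gen Γ (p u)) = h * gen Γ (p u) * h⁻¹) : g⁻¹ * h ∈ parabolic Γ {v}ᶜ := by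
  rcases eq_or_ne w u with rfl | hne
  · have hsub : star Γ (p w) ⊆ {v}ᶜ := subset_compl_singleton_iff.2 (mt mem_star_comm.1 hw)
    exact parabolic_mono hsub (inv_mul_mem_parabolic_star (hg.symm.trans hh))
  obtain ⟨F, hF, F_sum⟩ := exists_isLift_exponentSum_apply_eq hf hp hΛ
  choose k x hx hkx using fun w => exists_isCyclicallyReduced_conj (F (gen Λ w))
  have off := fun a ha => mem_parabolic_and_inv_mul_mem_of_reachableIn (φ := F.toMonoidHom)
    F_sum hx hkx hne (hwu a ha)
  have off' := fun a ha => mem_parabolic_and_inv_mul_mem_of_reachableIn (φ := F.toMonoidHom)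
    F_sum hx hkx hne.symm (hwu a ha).symm
  have hgk := hF.inv_mul_map_mem_parabolic hf.2 hw (fun a ha => (off a ha).1) (hkx w) hg
  have hhk := hF.inv_mul_map_mem_parabolic hf.2 hu (fun a ha => (off' a ha).1) (hkx u) hh
  have hkk := map_mem_parabolic_compl_singleton fun a ha => (off a ha).2
  rw [map_mul, map_inv] at hkk
  simpa [mul_assoc] using mul_mem (mul_mem hgk hkk) (inv_mem hhk)

end Conjugators

/-! ### Stars in a regular covering -/

section Fibers

open Set

variable {W : Type u} {V : Type v} {Λ : SimpleGraph W} {Γ : SimpleGraph V} {p : Λ →g Γ}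
  {v : V} {a b w u x y z : W}

theorem map_mem_star (φ : Λ →g Γ) (hw : w ∈ star Λ b) : φ w ∈ star Γ (φ b) :=
  hw.imp (congrArg φ) φ.map_adj

theorem mapsTo_compl_star (σ : Λ ≃g Γ) (b : W) : MapsTo σ (star Λ b)ᶜ (star Γ (σ b))ᶜ :=
  fun w hw hσw => hw <| by
    have hmem : σ.symm (σ w) ∈ star Λ (σ.symm (σ b)) := map_mem_star σ.symm.toHom hσw
    rwa [σ.symm_apply_apply, σ.symm_apply_apply] at hmem

theorem notMem_star_of_map_notMem (hb : p b = v) (hw : p w ∉ star Γ v) : w ∉ star Λ b :=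
  fun h => hw (hb ▸ map_mem_star p h)

theorem notMem_star_of_map_eq (hab : p a = p b) (hne : a ≠ b) : a ∉ star Λ b := by
  rintro (rfl | hadj)
  · exact hne rfl
  · exact (p.map_adj hadj).ne hab.symm

/-- The path component of `w` in the preimage of `Γ \ st(v)` contains a vertex at distance two from
the vertex `a` over `v`. -/
def Touches (p : Λ →g Γ) (v : V) (a w : W) : Prop :=
  ∃ y u, ReachableIn Λ (p ⁻¹' (star Γ v)ᶜ) w y ∧ Λ.Adj y u ∧ Λ.Adj u a

namespace Touches

theorem notMem_star : Touches p v a w → p w ∉ star Γ v := fun ⟨_, _, hwy, _⟩ => hwy.left_mem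

theorem of_adj (hw : p w ∉ star Γ v) (hwu : Λ.Adj w u) (hu : Touches p v a u) :
    Touches p v a w :=
  let ⟨y, z, huy, hyz, hza⟩ := hu
  ⟨y, z, (ReachableIn.of_adj hw huy.left_mem hwu).trans huy, hyz, hza⟩

theorem map {σ : Λ ≃g Λ} (hσ : IsDeck p σ) : Touches p v a w → Touches p v (σ a) (σ w) :=
  fun ⟨y, u, hwy, hyu, hua⟩ =>
    have hmaps : MapsTo σ (p ⁻¹' (star Γ v)ᶜ) (p ⁻¹' (star Γ v)ᶜ) := fun z hz => by
      rwa [mem_preimage, hσ]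
    ⟨σ y, σ u, hwy.map σ.toHom hmaps, σ.map_adj_iff.2 hyu, σ.map_adj_iff.2 hua⟩

theorem reachable : Touches p v a w → Λ.Reachable w a := fun ⟨_, _, hwy, hyu, hua⟩ =>
  (hwy.reachable.trans hyu.reachable).trans hua.reachable

theorem reachableIn (hp : ∀ w, InjOn p (Λ.neighborSet w)) (ha : p a = v) (hb : p b = v)
    (hab : a ≠ b) (hw : Touches p v a w) : ReachableIn Λ (star Λ b)ᶜ w a := by
  obtain ⟨y, u, hwy, hyu, hua⟩ := hw
  have hpab : p a = p b := ha.trans hb.symm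
  have hab' : a ∉ star Λ b := notMem_star_of_map_eq hpab hab
  have hu : u ∉ star Λ b := by
    rintro (rfl | hbu)
    · exact (p.map_adj hua).ne hpab.symm
    · exact hab (hp u hua hbu.symm hpab)
  have hwy' : ReachableIn Λ (star Λ b)ᶜ w y := hwy.mono fun _ => notMem_star_of_map_notMem hb
  have hyu' := ReachableIn.of_adj hwy'.symm.left_mem hu hyu
  exact (hwy'.trans hyu').trans (.of_adj hu hab' hua)

end Touches

/-- A geodesic from `z` to `x` cannot meet the star of `m`, as it would have to end there. -/
theorem reachableIn_compl_star_of_dist_le {m : W} (hp : ∀ w, InjOn p (Λ.neighborSet w))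
    (hx : p x = p m) (hxm : x ≠ m) (hzx : Λ.Reachable z x) (hd : Λ.dist z x ≤ Λ.dist z m) :
    ReachableIn Λ (star Λ m)ᶜ z x := by
  classical
  obtain ⟨q, hq⟩ := hzx.exists_walk_length_eq_dist
  refine ⟨q, fun y hy hym => ?_⟩
  have hsplit := congrArg SimpleGraph.Walk.length (q.take_spec hy)
  rw [SimpleGraph.Walk.length_append, hq] at hsplit
  rcases hym with rfl | hmy
  · have hdist := SimpleGraph.dist_le (q.takeUntil y hy)
    exact hxm (SimpleGraph.Walk.eq_of_length_eq_zero (p := q.dropUntil y hy) (by lia)).symm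
  · have hdist := SimpleGraph.dist_le ((q.takeUntil y hy).concat hmy.symm)
    rw [SimpleGraph.Walk.length_concat] at hdist
    have hlength : (q.dropUntil y hy).length = 0 ∨ (q.dropUntil y hy).length = 1 := by lia
    rcases hlength with h | h
    · obtain rfl := SimpleGraph.Walk.eq_of_length_eq_zero h
      exact (p.map_adj hmy).ne hx.symm
    · exact hxm (hp y (SimpleGraph.Walk.adj_of_length_eq_one h) hmy.symm hx)

/-- By regularity, `z` may be replaced by a vertex of its fiber at maximal distance from it. -/
theorem reachableIn_compl_star_of_map_eq [Finite W] (hp : IsRegularCovering p) (hx : p x = p z)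
    (hy : p y = p z) (hxz : x ≠ z) (hyz : y ≠ z) (hzx : Λ.Reachable z x) (hzy : Λ.Reachable z y) :
    ReachableIn Λ (star Λ z)ᶜ x y := by
  obtain ⟨m, ⟨hm, hzm⟩, hmax⟩ := exists_max_image {a | p a = p z ∧ Λ.Reachable z a}
    (Λ.dist z) (toFinite _) ⟨z, rfl, .refl _⟩
  obtain ⟨σ, hσ, rfl⟩ := hp.transitive m z hm
  have off_m {x} (hx : p x = p (σ m)) (hxz : x ≠ σ m) (hzx : Λ.Reachable (σ m) x) :
      ReachableIn Λ (star Λ m)ᶜ (σ m) (σ.symm x) := by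
    have hpx : p (σ.symm x) = p (σ m) := (hσ.symm x).trans hx
    have hreach : Λ.Reachable m (σ.symm x) := by simpa using hzx.map σ.symm.toHom
    refine reachableIn_compl_star_of_dist_le (fun w => (hp.bijOn w).injOn) (hpx.trans hm.symm) ?_
      (hzm.trans hreach) (hmax _ ⟨hpx, hzm.trans hreach⟩)
    rintro rfl
    exact hxz (σ.apply_symm_apply x).symm
  simpa using ((off_m hx hxz hzx).symm.trans (off_m hy hyz hzy)).map σ.toHom
    (mapsTo_compl_star σ m)

/-- The path component of `w` in the preimage of `Γ \ st(v)` touches two vertices over `v`. -/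
def Straddles (p : Λ →g Γ) (v : V) (w : W) : Prop :=
  ∃ a b, p a = v ∧ p b = v ∧ a ≠ b ∧ Touches p v a w ∧ Touches p v b w

theorem Straddles.notMem_star : Straddles p v w → p w ∉ star Γ v :=
  fun ⟨_, _, _, _, _, hw, _⟩ => hw.notMem_star

theorem Straddles.exists_reachableIn [Finite W] (hp : IsRegularCovering p)
    (hw : Straddles p v w) (hu : Straddles p v u) :
    ∃ u', p u' = p u ∧ ∀ a, p a = v → ReachableIn Λ (star Λ a)ᶜ w u' := by
  obtain ⟨a, a', ha, ha', haa', hwa, hwa'⟩ := hw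
  obtain ⟨b, b', hb, hb', hbb', hub, hub'⟩ := hu
  obtain ⟨σ, hσ, rfl⟩ := hp.transitive b a (hb.trans ha.symm)
  have hinj := fun w => (hp.bijOn w).injOn
  refine ⟨σ u, hσ u, fun c hc => ?_⟩
  by_cases hca : σ b = c
  · subst hca
    have hσb' : p (σ b') = v := (hσ b').trans hb'
    have hne : σ b' ≠ σ b := σ.injective.ne hbb'.symm
    have hlink : ReachableIn Λ (star Λ (σ b))ᶜ a' (σ b') :=
      reachableIn_compl_star_of_map_eq hp (ha'.trans ha.symm) (hσb'.trans ha.symm) haa'.symm hne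
        (hwa.reachable.symm.trans hwa'.reachable)
        ((hub.map hσ).reachable.symm.trans (hub'.map hσ).reachable)
    exact ((hwa'.reachableIn hinj ha' ha haa'.symm).trans hlink).trans
      ((hub'.map hσ).reachableIn hinj hσb' ha hne).symm
  · exact (hwa.reachableIn hinj ha hc hca).trans ((hub.map hσ).reachableIn hinj ha hc hca).symm

end Fibers

/-! ### Liftable partial conjugations -/

section Liftable

variable {W : Type u} {V : Type v} {Λ : SimpleGraph W} {Γ : SimpleGraph V} {p : Λ →g Γ}
  {f : MulAut (RAAG Γ)} {v : V} {C : Set V}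

open Classical in
/-- The endomorphism conjugating each vertex `b ∈ C` by `g b` and fixing the other vertices. Unlike
`conjHom`, it allows the conjugator to vary with the component of `C`. -/
noncomputable def multiConjHom (C : Set V) (g : V → RAAG Γ)
    (hg : ∀ b ∈ C, ∀ c ∈ C, Γ.Adj b c → g b = g c)
    (hg' : ∀ b ∈ C, ∀ c ∉ C, Γ.Adj b c → Commute (g b) (gen Γ c)) : RAAG Γ →* RAAG Γ :=
  lift (fun b => if b ∈ C then g b * gen Γ b * (g b)⁻¹ else gen Γ b) fun b c hbc => by
    have boundary {b c} (hb : b ∈ C) (hc : c ∉ C) (hbc : Γ.Adj b c) :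
        Commute (g b * gen Γ b * (g b)⁻¹) (gen Γ c) :=
      have hcomm := hg' b hb c hc hbc
      (hcomm.mul_left (gen_commute hbc)).mul_left hcomm.inv_left
    split_ifs with hb hc hc
    · exact hg b hb c hc hbc ▸ (Commute.conj_iff (g b)).2 (gen_commute hbc)
    · exact boundary hb hc hbc
    · exact (boundary hc hb hbc.symm).symm
    · exact gen_commute hbc

section MultiConjHom

variable {g k : V → RAAG Γ} {b : V} (hg : ∀ b ∈ C, ∀ c ∈ C, Γ.Adj b c → g b = g c)
  (hg' : ∀ b ∈ C, ∀ c ∉ C, Γ.Adj b c → Commute (g b) (gen Γ c))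
  (hk : ∀ b ∈ C, ∀ c ∈ C, Γ.Adj b c → k b = k c)
  (hk' : ∀ b ∈ C, ∀ c ∉ C, Γ.Adj b c → Commute (k b) (gen Γ c))

theorem multiConjHom_gen_of_mem (hb : b ∈ C) :
    multiConjHom C g hg hg' (gen Γ b) = g b * gen Γ b * (g b)⁻¹ := by
  rw [multiConjHom, lift_gen, if_pos hb]

theorem multiConjHom_gen_of_notMem (hb : b ∉ C) :
    multiConjHom C g hg hg' (gen Γ b) = gen Γ b := by
  rw [multiConjHom, lift_gen, if_neg hb]

theorem multiConjHom_comp_multiConjHom (hkg : ∀ b, k b * g b = 1)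
    (hfix : ∀ b, multiConjHom C g hg hg' (k b) = k b) :
    (multiConjHom C g hg hg').comp (multiConjHom C k hk hk') = MonoidHom.id _ := by
  refine PresentedGroup.ext fun b => ?_
  change multiConjHom C g hg hg' (multiConjHom C k hk hk' (gen Γ b)) = gen Γ b
  by_cases hb : b ∈ C
  · rw [multiConjHom_gen_of_mem hk hk' hb, map_mul, map_mul, map_inv, hfix,
      multiConjHom_gen_of_mem hg hg' hb, eq_inv_of_mul_eq_one_left (hkg b)]
    group
  · rw [multiConjHom_gen_of_notMem hk hk' hb, multiConjHom_gen_of_notMem hg hg' hb]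

end MultiConjHom

theorem exists_mulAut_conj_gen {c : V → V} (hc : ∀ b, c b ∉ C)
    (hcC : ∀ b ∈ C, ∀ d ∈ C, Γ.Adj b d → c b = c d)
    (hcC' : ∀ b ∈ C, ∀ d ∉ C, Γ.Adj b d → Commute (gen Γ (c b)) (gen Γ d)) :
    ∃ F : MulAut (RAAG Γ),
      (∀ b ∈ C, F (gen Γ b) = gen Γ (c b) * gen Γ b * (gen Γ (c b))⁻¹) ∧
        ∀ b ∉ C, F (gen Γ b) = gen Γ b := by
  have hg : ∀ b ∈ C, ∀ d ∈ C, Γ.Adj b d → gen Γ (c b) = gen Γ (c d) :=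
    fun b hb d hd hbd => congrArg (gen Γ) (hcC b hb d hd hbd)
  have hk : ∀ b ∈ C, ∀ d ∈ C, Γ.Adj b d → (gen Γ (c b))⁻¹ = (gen Γ (c d))⁻¹ :=
    fun b hb d hd hbd => congrArg _ (hg b hb d hd hbd)
  have hk' : ∀ b ∈ C, ∀ d ∉ C, Γ.Adj b d → Commute (gen Γ (c b))⁻¹ (gen Γ d) :=
    fun b hb d hd hbd => (hcC' b hb d hd hbd).inv_left
  exact ⟨MonoidHom.toMulEquiv (multiConjHom C (fun b => gen Γ (c b)) hg hcC')
    (multiConjHom C (fun b => (gen Γ (c b))⁻¹) hk hk')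
    (multiConjHom_comp_multiConjHom hk hk' hg hcC' (fun b => mul_inv_cancel _)
      fun b => multiConjHom_gen_of_notMem hk hk' (hc b))
    (multiConjHom_comp_multiConjHom hg hcC' hk hk' (fun b => inv_mul_cancel _)
      fun b => by rw [map_inv, multiConjHom_gen_of_notMem hg hcC' (hc b)]),
    fun b => multiConjHom_gen_of_mem hg hcC', fun b => multiConjHom_gen_of_notMem hg hcC'⟩

theorem exists_touches_of_mem_range (p : Λ →g Γ) (hv : v ∈ Set.range p) :
    ∃ c : W → W, (∀ w, p (c w) = v) ∧
      (∀ w a, p a = v → Touches p v a w → Touches p v (c w) w) ∧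
      ∀ w u, p w ∉ star Γ v → p u ∉ star Γ v → Λ.Adj w u → c w = c u := by
  have exists_pick (A : Set W) : ∃ b, p b = v ∧ ∀ a ∈ A, p a = v → b ∈ A := by
    by_cases hA : ∃ a ∈ A, p a = v
    · obtain ⟨a, ha, hpa⟩ := hA
      exact ⟨a, hpa, fun _ _ _ => ha⟩
    · obtain ⟨b, hb⟩ := hv
      exact ⟨b, hb, fun a ha hpa => absurd ⟨a, ha, hpa⟩ hA⟩
  choose pick pick_over pick_mem using exists_pick
  refine ⟨fun w => pick {a | Touches p v a w}, fun w => pick_over _,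
    fun w a hpa ha => pick_mem {a | Touches p v a w} a ha hpa, fun w u hw hu hwu => ?_⟩
  exact congrArg pick (Set.ext fun a => ⟨.of_adj hu hwu.symm, .of_adj hw hwu⟩)

theorem partialConj_mem_LAut_of_forall_not_straddles (hp : IsCovering p)
    (hC : IsUnionOfComponents Γ v C) (hno : ∀ w, p w ∈ C → ¬ Straddles p v w) :
    partialConj v C hC ∈ LAut p := by
  obtain ⟨c, hcv, hc_touches, hc_adj⟩ := exists_touches_of_mem_range p (hp.surjective v)
  have hvC : v ∉ C := fun h => hC.notMem_star h (Set.mem_insert _ _)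
  have hboundary : ∀ w ∈ p ⁻¹' C, ∀ u ∉ p ⁻¹' C, Λ.Adj w u →
      Commute (gen Λ (c w)) (gen Λ u) := by
    intro w hw u hu hwu
    have hpuv : Γ.Adj (p u) v := by
      have hstar : p u ∈ star Γ v := not_not.1 fun h => hu (hC.mem_of_adj hw (p.map_adj hwu) h)
      rcases hstar with h | h
      · exact absurd (Or.inr (h ▸ (p.map_adj hwu).symm)) (hC.notMem_star hw)
      · exact h.symm
    obtain ⟨a, hua, ha⟩ := (hp.bijOn u).surjOn hpuv
    have hwa : Touches p v a w :=
      ⟨w, u, ⟨.nil, by simpa using hC.notMem_star hw⟩, hwu, hua⟩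
    have hca : c w = a := by
      by_contra hne
      exact hno w hw ⟨_, _, hcv w, ha, hne, hc_touches w a ha hwa, hwa⟩
    exact hca ▸ gen_commute hua.symm
  obtain ⟨F, hF, hF'⟩ := exists_mulAut_conj_gen (C := p ⁻¹' C)
    (fun w => by rwa [Set.mem_preimage, hcv])
    (fun w hw u hu => hc_adj w u (hC.notMem_star hw) (hC.notMem_star hu)) hboundary
  refine ⟨F, isLift_of_forall_gen fun w => ?_⟩
  by_cases hw : p w ∈ C
  · rw [partialConj_gen_of_mem hC hw, hF w hw, map_mul, map_mul, map_inv, map_gen, map_gen, hcv]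
  · rw [partialConj_gen_of_notMem hC hw, hF' w hw, map_gen]

theorem conj_map_mem_LAut (x : RAAG Λ) : MulAut.conj (map p x) ∈ LAut p :=
  ⟨MulAut.conj x, fun y => by simp only [MulAut.conj_apply, map_mul, map_inv]⟩

theorem partialConj_mul_partialConj_compl (hC : IsUnionOfComponents Γ v C)
    (hC' : IsUnionOfComponents Γ v {b | b ∉ star Γ v ∧ b ∉ C}) :
    partialConj v C hC * partialConj v _ hC' = MulAut.conj (gen Γ v) := by
  have hv : v ∉ C := fun h => hC.notMem_star h (Set.mem_insert _ _)
  have eq_on_gen : (partialConj v C hC * partialConj v _ hC').toMonoidHom =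
      (MulAut.conj (gen Γ v)).toMonoidHom := PresentedGroup.ext fun b => by
    change partialConj v C hC (partialConj v _ hC' (gen Γ b)) = gen Γ v * gen Γ b * (gen Γ v)⁻¹
    by_cases hb : b ∈ C
    · rw [partialConj_gen_of_notMem hC' (fun h => h.2 hb), partialConj_gen_of_mem hC hb]
    by_cases hbv : b ∈ star Γ v
    · rw [partialConj_gen_of_notMem hC' (fun h => h.1 hbv), partialConj_gen_of_notMem hC hb,
        ← (commute_gen_of_mem_parabolic_star (gen_mem_parabolic hbv)).eq, mul_inv_cancel_right]
    · rw [partialConj_gen_of_mem hC' ⟨hbv, hb⟩, map_mul, map_mul, map_inv,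
        partialConj_gen_of_notMem hC hb, partialConj_gen_of_notMem hC hv]
  exact MulEquiv.toMonoidHom_injective eq_on_gen

/-- The complementary partial conjugation is liftable, and the product of the two is inner. -/
theorem partialConj_mem_LAut_of_forall_straddles (hp : IsCovering p)
    (hC : IsUnionOfComponents Γ v C) (hall : ∀ w, Straddles p v w → p w ∈ C) :
    partialConj v C hC ∈ LAut p := by
  have hC' : IsUnionOfComponents Γ v {b | b ∉ star Γ v ∧ b ∉ C} :=
    isUnionOfComponents_of_forall_adj (fun b hb => hb.1) fun b hb c hc hbc =>
      ⟨hc, fun h => hb.2 (hC.mem_of_adj h hbc.symm hb.1)⟩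
  have hcompl := partialConj_mem_LAut_of_forall_not_straddles hp hC' fun w hw hs =>
    hw.2 (hall w hs)
  obtain ⟨a, rfl⟩ := hp.surjective v
  have hinner := conj_map_mem_LAut (p := p) (gen Λ a)
  rw [map_gen, ← partialConj_mul_partialConj_compl hC hC'] at hinner
  exact (Subgroup.mul_mem_cancel_right _ hcompl).1 hinner

/-- The rigidity of the conjugators of `f` implies that `conjugatedInto f v K` contains the images
of either all the straddling components or none of them. -/
theorem partialConj_conjugatedInto_mem_LAut [Finite W] (hp : IsRegularCovering p)
    (hΓ : ∀ a, ¬ Γ.IsIsolated a) (hf : f ∈ LPAut p) {K : Set (RAAG Γ)} (hK : K ∈ halfspaces Γ v) :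
    partialConj v (conjugatedInto f v K) (isUnionOfComponents_conjugatedInto hf.2 hK) ∈
      LAut p := by
  have hC := isUnionOfComponents_conjugatedInto hf.2 hK
  by_cases! hno : ∀ w, p w ∈ conjugatedInto f v K → ¬ Straddles p v w
  · exact partialConj_mem_LAut_of_forall_not_straddles hp.toIsCovering hC hno
  obtain ⟨w, hw, hws⟩ := hno
  refine partialConj_mem_LAut_of_forall_straddles hp.toIsCovering hC fun u hus => ?_
  obtain ⟨u', hu', hwu'⟩ := hws.exists_reachableIn hp hus
  obtain ⟨g, hg⟩ := isConj_iff.1 (hf.2 (p w))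
  obtain ⟨h, hh⟩ := isConj_iff.1 (hf.2 (p u'))
  have hu'v : p u' ∉ star Γ v := hu' ▸ hus.notMem_star
  have hgh : g⁻¹ * h ∈ parabolic Γ {v}ᶜ :=
    inv_mul_mem_parabolic_of_forall_reachableIn (fun w => (hp.bijOn w).injOn)
      (hp.not_isIsolated hΓ) hf (hC.notMem_star hw) hu'v hwu' hg.symm hh.symm
  have hgK : g ∈ K := ((mem_conjugatedInto_iff hK hg.symm).1 hw).2
  have hhK : h ∈ K := by
    rwa [← mul_inv_cancel_left g h, mul_parabolic_mem_iff hK (by simp) hgh]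
  exact hu' ▸ (mem_conjugatedInto_iff hK hh.symm).2 ⟨hu'v, hhK⟩

theorem mem_closure_partialConj_of_mem_LPAut [Finite W] (hp : IsRegularCovering p)
    (hΓ : ∀ a, ¬ Γ.IsIsolated a) (hf : f ∈ LPAut p) :
    f ∈ Subgroup.closure {f | f ∈ LAut p ∧ IsPartialConj f} := by
  have : Finite V := .of_surjective p hp.surjective
  cases nonempty_fintype V
  induction hn : ∑ b, conjLength f b using Nat.strong_induction_on generalizing f with
  | _ n ih =>
    subst hn
    rcases eq_or_ne f 1 with rfl | hne
    · exact one_mem _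
    obtain ⟨a, K, hK, P, hP, hle, b, hlt⟩ := exists_conjLength_mul_lt hf.2 hne
    have hC := isUnionOfComponents_conjugatedInto hf.2 hK
    have hliftable := partialConj_conjugatedInto_mem_LAut hp hΓ hf hK
    have hle_closure : Subgroup.zpowers (partialConj a _ hC) ≤
        Subgroup.closure {f | f ∈ LAut p ∧ IsPartialConj f} :=
      Subgroup.zpowers_le.2 (Subgroup.subset_closure ⟨hliftable, a, _, hC, rfl⟩)
    have hle_LPAut : Subgroup.zpowers (partialConj a _ hC) ≤ LPAut p :=
      Subgroup.zpowers_le.2 ⟨hliftable, partialConj_mem_PAut hC⟩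
    have hsum : ∑ b, conjLength (f * P) b < ∑ b, conjLength f b :=
      Finset.sum_lt_sum (fun b _ => hle b) ⟨b, Finset.mem_univ _, hlt⟩
    exact (Subgroup.mul_mem_cancel_right _ (hle_closure hP)).1
      (ih _ hsum (mul_mem hf (hle_LPAut hP)) rfl)

end Liftable

end RAAG

theorem mainTheorem2 {W V : Type*} [Finite W] [Finite V] {Λ : SimpleGraph W} {Γ : SimpleGraph V}
    (p : Λ →g Γ) (hp : RAAG.IsRegularCovering p) (hΓ : ∀ a, ¬ Γ.IsIsolated a) :
    Subgroup.closure {f : MulAut (RAAG Γ) | f ∈ RAAG.LAut p ∧ RAAG.IsPartialConj f} =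
      RAAG.LPAut p := by
  refine le_antisymm ((Subgroup.closure_le _).2 ?_) fun f hf =>
    RAAG.mem_closure_partialConj_of_mem_LPAut hp hΓ hf
  rintro f ⟨hf, a, C, hC, rfl⟩
  exact ⟨hf, RAAG.partialConj_mem_PAut hC⟩
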